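/- **Setting.** Let $N\in\mathbb N$, $T>0$. A function $f$ is piecewise continuous on $[0,T]$ if it is continuous off a finite set and has finite one-sided limits everywhere (its values at jumps are arbitrary). The network topology is given by times $0=t_0<\dots<t_m=T$ and $0/1$ adjacency matrices $A_1,\dots,A_m$, with $(a_{ij}(t))=A_k$ on the slot $(t_{k-1},t_k)$. Let $\beta_i,\alpha_i$ be piecewise continuous on $[0,T]$ ($1\le i\le N$), $a^1_i,a^2_i,b_i\in\mathbb R$, and let $[\underline{\lambda_i},\overline{\lambda_i}]$, $[\underline{\delta_i},\overline{\delta_i}]$, $[\underline{\gamma_i},\overline{\gamma_i}]$ be intervals; let $\phi_i$ be continuous on $[\underline{\delta_i},\overline{\delta_i}]$, $\varrho^1_i$ continuous on $[\underline{\gamma_i},\overline{\gamma_i}]$, $\varrho^2_i$ continuous on $[1-\overline{\gamma_i},1-\underline{\gamma_i}]$; let $\mathbf E_0\in\mathbb R^{3N}$. Let $\mathcal W$ be the set of controls $\mathbf w=(\lambda_i,\delta_i,\gamma_i)_{i\le N}$ that are piecewise continuous on $[0,T]$ with $\lambda_i(t)\in[\underline{\lambda_i},\overline{\lambda_i}]$,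 $\delta_i(t)\in[\underline{\delta_i},\overline{\delta_i}]$, $\gamma_i(t)\in[\underline{\gamma_i},\overline{\gamma_i}]$ for all $t\in[0,T]$ and all $i$. With $Q_i=1-H_i-M_i-S_i$ (the quarantine probability) and $\theta_i=\beta_i(t)+\alpha_i(t)\sum_j a_{ij}(t)M_j+\alpha_i(t)\sum_j a_{ij}(t)S_j$, the state $\mathbf E=(H_i,M_i,S_i)_{i\le N}$ associated with $\mathbf w$ is continuous on $[0,T]$ and satisfies $\mathbf E(0)=\mathbf E_0$ and, at all but finitely many $t\in(0,T)$, $$\dot H_i=\gamma_iQ_i-H_i\theta_i,\qquad \dot M_i=H_i\theta_i-\lambda_iM_i,\qquad \dot S_i=\lambda_iM_i-\delta_iS_i .$$ The PPAC problem is to minimize over all $\mathbf w\in\mathcal W$ with associated state $\mathbf E$ the impact $\int_0^T I(\mathbf E(t),\mathbf w(t))\,dt$, where $$I(\mathbf E,\mathbf w)=\sum_i\big[(\phi_i(\delta_i)+a^2_i)S_i+a^1_iM_i\big]+\sum_i\big[b_i+\varrho^1_i(\gamma_i)+\varrho^2_i(1-\gamma_i)\big]Q_i .$$ Its Hamiltonian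 is $$\mathcal H(t,\mathbf E,\mathbf w,\kappa,\rho,\xi)=I(\mathbf E,\mathbf w)+\sum_i\kappa_i(\gamma_iQ_i-H_i\theta_i)+\sum_i\rho_i(H_i\theta_i-\lambda_iM_i)+\sum_i\xi_i(\lambda_iM_i-\delta_iS_i).$$ **Theorem.** Let $\mathbf w$ be an optimal control of the PPAC problem with state trajectory $\mathbf E$. Then there are continuous functions $\kappa=(\kappa_i)$, $\rho=(\rho_i)$, $\xi=(\xi_i)$ on $[0,T]$ with $\kappa(T)=\rho(T)=\xi(T)=0$ such that, at all but finitely many $t\in(0,T)$ and for all $i$, $$\dot\kappa_i=-\frac{\partial\mathcal H}{\partial H_i},\qquad \dot\rho_i=-\frac{\partial\mathcal H}{\partial M_i},\qquad \dot\xi_i=-\frac{\partial\mathcal H}{\partial S_i}$$ along $(\mathbf E(t),\mathbf w(t),\kappa(t),\rho(t),\xi(t))$, and moreover, for all $i$ and all $t\in[0,T]$, $$\delta_i(t)\in\arg\min_{\delta\in[\underline{\delta_i},\overline{\delta_i}]}S_i(t)\,[\phi_i(\delta)-\xi_i(t)\delta],$$ $$\lambda_i(t)\in\arg\min_{\lambda\in[\underline{\lambda_i},\overline{\lambda_i}]}M_i(t)\,[\xi_i(t)\lambda-\rho_i(t)\lambda],$$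 $$\gamma_i(t)\in\arg\min_{\gamma\in[\underline{\gamma_i},\overline{\gamma_i}]}Q_i(t)\,[\varrho^1_i(\gamma)+\varrho^2_i(1-\gamma)+\kappa_i(t)\gamma],$$ where each of the three assertions is made at those $t$ at which the control component concerned is right-continuous (with $t<T$) or left-continuous (with $t>0$). This is the case at all but finitely many $t$, and at every $t\in[0,T]$ if, as one may, the controls are normalized to take one of their one-sided limits at each time. -/

import Mathlib

open Set Filter Topology

namespace PPAC

/-- `f` is piecewise continuous on `[0, T]`: it is continuous on `[0, T]` off a finite set and has
finite one-sided limits everywhere. The values at the jumps are arbitrary. -/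
def PiecewiseContinuous (T : ℝ) (f : ℝ → ℝ) : Prop :=
  (∃ D : Set ℝ, D.Finite ∧ ∀ t ∈ Icc 0 T \ D, ContinuousWithinAt f (Icc 0 T) t) ∧
  (∀ t ∈ Ico 0 T, ∃ l : ℝ, Tendsto f (𝓝[>] t) (𝓝 l)) ∧
  (∀ t ∈ Ioc 0 T, ∃ l : ℝ, Tendsto f (𝓝[<] t) (𝓝 l))

/-- `f`, seen as a function on `[0, T]`, is right-continuous at some `t < T` or left-continuous at
some `t > 0`; that is, `f t` is a genuine one-sided limit and not an isolated value. -/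
def OneSidedContinuousAt (T : ℝ) (f : ℝ → ℝ) (t : ℝ) : Prop :=
  (t < T ∧ ContinuousWithinAt f (Icc t T) t) ∨ (0 < t ∧ ContinuousWithinAt f (Icc 0 t) t)

/-- The set of minimizers of `f` over `s`. -/
def argminOn (f : ℝ → ℝ) (s : Set ℝ) : Set ℝ := {x | x ∈ s ∧ ∀ y ∈ s, f x ≤ f y}

/-- A topology schedule on `[0, T]`: times `0 = t_0 < t_1 < ⋯ < t_m = T` and the adjacency matrix
of the network in each of the `m` time slots. -/
structure Schedule (N : ℕ) (T : ℝ) where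
  slots : ℕ
  time : Fin (slots + 1) → ℝ
  time_strictMono : StrictMono time
  time_zero : time 0 = 0
  time_last : time (Fin.last slots) = T
  A : Fin slots → Matrix (Fin N) (Fin N) ℝ
  A_entry : ∀ k i j, A k i j = 0 ∨ A k i j = 1

open Classical in
/-- The entry `a_{ij}(t)`: the entry of the matrix of the slot that contains `t` (slots are disjoint,
so at most one summand is non-zero). The choice made at the finitely many slot ends is immaterial. -/
noncomputable def Schedule.a {N : ℕ} {T : ℝ} (G : Schedule N T) (t : ℝ) (i j : Fin N) : ℝ :=
  ∑ k : Fin G.slots, if G.time k.castSucc < t ∧ t ≤ G.time k.succ then G.A k i j else 0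

/-- Values of the state `E = (H, M, S)`: healthy, mild, severe. -/
@[ext] structure State (N : ℕ) where
  H : Fin N → ℝ
  M : Fin N → ℝ
  S : Fin N → ℝ

/-- Values of the control `w = (λ, δ, γ)`: threat, quarantine and recovery rates. -/
@[ext] structure Control (N : ℕ) where
  lam : Fin N → ℝ
  del : Fin N → ℝ
  gam : Fin N → ℝ

/-- Values of the adjoint `(κ, ρ, ξ)`, dual to `(H, M, S)`. -/
@[ext] structure Costate (N : ℕ) where
  kap : Fin N → ℝ
  rho : Fin N → ℝ
  xi : Fin N → ℝ

/-- The probability `1 - H_i - M_i - S_i` of node `i` being quarantined. -/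
def State.Q {N : ℕ} (E : State N) (i : Fin N) : ℝ := 1 - E.H i - E.M i - E.S i

/-- The data of the precise prevention and control problem on `[0, T]` with `N` nodes. -/
structure Problem (N : ℕ) where
  T : ℝ
  T_pos : 0 < T
  /-- time-varying topology -/
  G : Schedule N T
  /-- rates of direct infiltration `β_i(t)` and of lateral movement `α_i(t)` -/
  beta : Fin N → ℝ → ℝ
  alpha : Fin N → ℝ → ℝ
  beta_pc : ∀ i, PiecewiseContinuous T (beta i)
  alpha_pc : ∀ i, PiecewiseContinuous T (alpha i)
  /-- resource consumption of mild (`a1`) and severe (`a2`) nodes, service loss `b` -/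
  a1 : Fin N → ℝ
  a2 : Fin N → ℝ
  b : Fin N → ℝ
  /-- quarantine cost `φ_i` and recovery costs `ϱ¹_i`, `ϱ²_i` -/
  phi : Fin N → ℝ → ℝ
  vrho1 : Fin N → ℝ → ℝ
  vrho2 : Fin N → ℝ → ℝ
  /-- lower and upper bounds of the rates -/
  lamLo : Fin N → ℝ
  lamHi : Fin N → ℝ
  delLo : Fin N → ℝ
  delHi : Fin N → ℝ
  gamLo : Fin N → ℝ
  gamHi : Fin N → ℝ
  /-- the cost functions are continuous on the ranges on which they are used -/
  phi_cont : ∀ i, ContinuousOn (phi i) (Icc (delLo i) (delHi i))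
  vrho1_cont : ∀ i, ContinuousOn (vrho1 i) (Icc (gamLo i) (gamHi i))
  vrho2_cont : ∀ i, ContinuousOn (vrho2 i) (Icc (1 - gamHi i) (1 - gamLo i))
  /-- initial state `E_0` -/
  E0 : State N

namespace Problem

variable {N : ℕ} (P : Problem N)

/-- The infection rate `β_i(t) + α_i(t) ∑_j a_{ij}(t) M_j + α_i(t) ∑_j a_{ij}(t) S_j`. -/
noncomputable def infection (t : ℝ) (E : State N) (i : Fin N) : ℝ :=
  P.beta i t + P.alpha i t * ∑ j, P.G.a t i j * E.M j + P.alpha i t * ∑ j, P.G.a t i j * E.S j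

/-- Right-hand side of `dH_i/dt`. -/
noncomputable def dH (t : ℝ) (E : State N) (u : Control N) (i : Fin N) : ℝ :=
  u.gam i * E.Q i - E.H i * P.infection t E i

/-- Right-hand side of `dM_i/dt`. -/
noncomputable def dM (t : ℝ) (E : State N) (u : Control N) (i : Fin N) : ℝ :=
  E.H i * P.infection t E i - u.lam i * E.M i

/-- Right-hand side of `dS_i/dt`. -/
def dS (_P : Problem N) (E : State N) (u : Control N) (i : Fin N) : ℝ :=
  u.lam i * E.M i - u.del i * E.S i

/-- Instantaneous expected impact `I(E, w)`. -/
noncomputable def runningCost (E : State N) (u : Control N) : ℝ :=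
  ∑ i, ((P.phi i (u.del i) + P.a2 i) * E.S i + P.a1 i * E.M i) +
  ∑ i, (P.b i + P.vrho1 i (u.gam i) + P.vrho2 i (1 - u.gam i)) * E.Q i

/-- Total expected impact `∫_0^T I(E(t), w(t)) dt`. -/
noncomputable def impact (w : ℝ → Control N) (E : ℝ → State N) : ℝ :=
  ∫ t in (0 : ℝ)..P.T, P.runningCost (E t) (w t)

/-- The set `𝒲` of piecewise continuous controls with values in the box. -/
def admissible : Set (ℝ → Control N) :=
  {w | (∀ i, PiecewiseContinuous P.T (fun t => (w t).lam i) ∧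
          PiecewiseContinuous P.T (fun t => (w t).del i) ∧
          PiecewiseContinuous P.T (fun t => (w t).gam i)) ∧
       ∀ t ∈ Icc 0 P.T, ∀ i, (w t).lam i ∈ Icc (P.lamLo i) (P.lamHi i) ∧
          (w t).del i ∈ Icc (P.delLo i) (P.delHi i) ∧
          (w t).gam i ∈ Icc (P.gamLo i) (P.gamHi i)}

/-- `E` solves the state system under the control `w`: it is continuous on `[0, T]`, satisfies the
differential equations at all but finitely many times, and starts at `E_0`. -/
def IsStateTrajectory (w : ℝ → Control N) (E : ℝ → State N) : Prop :=
  E 0 = P.E0 ∧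
  (∀ i, ContinuousOn (fun t => (E t).H i) (Icc 0 P.T) ∧
    ContinuousOn (fun t => (E t).M i) (Icc 0 P.T) ∧
    ContinuousOn (fun t => (E t).S i) (Icc 0 P.T)) ∧
  ∃ D : Set ℝ, D.Finite ∧ ∀ t ∈ Ioo 0 P.T \ D, ∀ i,
    HasDerivAt (fun s => (E s).H i) (P.dH t (E t) (w t) i) t ∧
    HasDerivAt (fun s => (E s).M i) (P.dM t (E t) (w t) i) t ∧
    HasDerivAt (fun s => (E s).S i) (P.dS (E t) (w t) i) t

/-- `w` is an optimal control with state trajectory `E`. -/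
def IsOptimal (w : ℝ → Control N) (E : ℝ → State N) : Prop :=
  w ∈ P.admissible ∧ P.IsStateTrajectory w E ∧
  ∀ w' ∈ P.admissible, ∀ E', P.IsStateTrajectory w' E' → P.impact w E ≤ P.impact w' E'

/-- The Hamiltonian at time `t`. -/
noncomputable def hamiltonian (t : ℝ) (E : State N) (u : Control N) (p : Costate N) : ℝ :=
  P.runningCost E u + ∑ i, p.kap i * P.dH t E u i + ∑ i, p.rho i * P.dM t E u i +
    ∑ i, p.xi i * P.dS E u i

/-- `p = (κ, ρ, ξ)` is an adjoint along `(w, E)`: continuous on `[0, T]`, zero at time `T`, and at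
all but finitely many times the partial derivatives of the Hamiltonian in `H_i`, `M_i`, `S_i` exist
and their negatives are the time derivatives of `κ_i`, `ρ_i`, `ξ_i`. -/
def IsAdjoint (w : ℝ → Control N) (E : ℝ → State N) (p : ℝ → Costate N) : Prop :=
  (∀ i, (p P.T).kap i = 0 ∧ (p P.T).rho i = 0 ∧ (p P.T).xi i = 0) ∧
  (∀ i, ContinuousOn (fun t => (p t).kap i) (Icc 0 P.T) ∧
    ContinuousOn (fun t => (p t).rho i) (Icc 0 P.T) ∧
    ContinuousOn (fun t => (p t).xi i) (Icc 0 P.T)) ∧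
  ∃ D : Set ℝ, D.Finite ∧ ∀ t ∈ Ioo 0 P.T \ D, ∀ i,
    (∃ d : ℝ, HasDerivAt (fun x => P.hamiltonian t
        { E t with H := Function.update (E t).H i x } (w t) (p t)) d ((E t).H i) ∧
      HasDerivAt (fun s => (p s).kap i) (-d) t) ∧
    (∃ d : ℝ, HasDerivAt (fun x => P.hamiltonian t
        { E t with M := Function.update (E t).M i x } (w t) (p t)) d ((E t).M i) ∧
      HasDerivAt (fun s => (p s).rho i) (-d) t) ∧
    (∃ d : ℝ, HasDerivAt (fun x => P.hamiltonian t
        { E t with S := Function.update (E t).S i x } (w t) (p t)) d ((E t).S i) ∧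
      HasDerivAt (fun s => (p s).xi i) (-d) t)

end Problem

end PPAC

namespace PPAC

section BoundedContinuousOff

variable {E F : Type*} [NormedAddCommGroup E] [NormedAddCommGroup F]

/-- `g` is bounded on `[0, T]` and continuous at the points of `(0, T)` outside `D`. -/
def BddContOff (T : ℝ) (D : Set ℝ) (g : ℝ → E) : Prop :=
  (∃ C, ∀ t ∈ Icc 0 T, ‖g t‖ ≤ C) ∧ ∀ t ∈ Ioo 0 T \ D, ContinuousAt g t

namespace BddContOff

variable {T : ℝ} {D D' : Set ℝ} {f g : ℝ → E}

theorem mono (hg : BddContOff T D g) (h : D ⊆ D') : BddContOff T D' g :=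
  ⟨hg.1, fun t ht => hg.2 t ⟨ht.1, fun h' => ht.2 (h h')⟩⟩

theorem of_continuousOn (hg : ContinuousOn g (Icc 0 T)) : BddContOff T D g :=
  ⟨isCompact_Icc.exists_bound_of_continuousOn hg,
    fun _ ht => hg.continuousAt (Icc_mem_nhds ht.1.1 ht.1.2)⟩

theorem prodMk {h : ℝ → F} (hg : BddContOff T D g) (hh : BddContOff T D h) :
    BddContOff T D (fun t => (g t, h t)) := by
  obtain ⟨⟨C, hC⟩, hg⟩ := hg
  obtain ⟨⟨C', hC'⟩, hh⟩ := hh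
  exact ⟨⟨max C C', fun t ht => max_le_max (hC t ht) (hC' t ht)⟩,
    fun t ht => (hg t ht).prodMk (hh t ht)⟩

theorem pi {ι : Type*} [Fintype ι] {g : ℝ → ι → E}
    (hg : ∀ i, BddContOff T D (fun t => g t i)) : BddContOff T D g := by
  choose C hC using fun i => (hg i).1
  refine ⟨⟨∑ i, |C i|, fun t ht => ?_⟩, fun t ht => continuousAt_pi.2 fun i => (hg i).2 t ht⟩
  refine (pi_norm_le_iff_of_nonneg (by positivity)).2 fun i => ?_
  exact ((hC i t ht).trans (le_abs_self _)).trans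
    (Finset.single_le_sum (f := fun i => |C i|) (fun _ _ => abs_nonneg _) (Finset.mem_univ i))

theorem comp [ProperSpace E] {φ : E → F} (hφ : Continuous φ) (hg : BddContOff T D g) :
    BddContOff T D (fun t => φ (g t)) := by
  obtain ⟨⟨C, hC⟩, hg⟩ := hg
  obtain ⟨C', hC'⟩ :=
    (isCompact_closedBall (0 : E) C).exists_bound_of_continuousOn hφ.continuousOn
  exact ⟨⟨C', fun t ht => hC' _ (by simpa using hC t ht)⟩,
    fun t ht => hφ.continuousAt.comp (hg t ht)⟩

theorem intervalIntegrable [SecondCountableTopology E] (hD : D.Finite)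
    (hg : BddContOff T D g) {a b : ℝ} (ha : a ∈ Icc 0 T) (hb : b ∈ Icc 0 T) :
    IntervalIntegrable g MeasureTheory.volume a b := by
  obtain ⟨⟨C, hC⟩, hg⟩ := hg
  rcases le_or_gt T 0 with hT | hT
  · obtain rfl : a = b := by linarith [ha.1, ha.2, hb.1, hb.2]
    exact IntervalIntegrable.refl
  have hm : MeasureTheory.AEStronglyMeasurable g
      (MeasureTheory.volume.restrict (Ioc 0 T)) := by
    have h1 : MeasureTheory.AEStronglyMeasurable g
        (MeasureTheory.volume.restrict (Ioo 0 T \ D)) :=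
      ContinuousOn.aestronglyMeasurable (fun t ht => (hg t ht).continuousWithinAt)
        (measurableSet_Ioo.diff hD.measurableSet)
    have h2 : (Ioo 0 T \ D : Set ℝ) =ᵐ[MeasureTheory.volume] Ioc 0 T := by
      refine (MeasureTheory.sdiff_null_ae_eq_self (hD.measure_zero _)).trans
        MeasureTheory.Ioo_ae_eq_Ioc
    rwa [MeasureTheory.Measure.restrict_congr_set h2] at h1
  have h3 : IntervalIntegrable g MeasureTheory.volume 0 T := by
    rw [intervalIntegrable_iff_integrableOn_Ioc_of_le hT.le]
    refine MeasureTheory.IntegrableOn.of_bound measure_Ioc_lt_top hm C ?_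
    exact (MeasureTheory.ae_restrict_mem measurableSet_Ioc).mono
      fun t ht => hC t (Ioc_subset_Icc_self ht)
  exact h3.mono_set (uIcc_subset_uIcc (by rwa [uIcc_of_le hT.le]) (by rwa [uIcc_of_le hT.le]))

end BddContOff

open Classical in
/-- The function `f`, replaced by `g` on `(a, b]`. -/
noncomputable def splice {α : Type*} (a b : ℝ) (f g : ℝ → α) (t : ℝ) : α :=
  if t ∈ Ioc a b then g t else f t

theorem splice_of_mem {α : Type*} {a b t : ℝ} {f g : ℝ → α} (h : t ∈ Ioc a b) :
    splice a b f g t = g t := if_pos h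

theorem splice_of_notMem {α : Type*} {a b t : ℝ} {f g : ℝ → α} (h : t ∉ Ioc a b) :
    splice a b f g t = f t := if_neg h

theorem apply_splice {α β : Type*} (φ : α → β) (a b : ℝ) (f g : ℝ → α) (t : ℝ) :
    φ (splice a b f g t) = splice a b (fun s => φ (f s)) (fun s => φ (g s)) t :=
  apply_ite φ _ _ _

theorem splice_eventuallyEq {α : Type*} {a b t : ℝ} (f g : ℝ → α) (ha : t ≠ a) (hb : t ≠ b) :
    splice a b f g =ᶠ[𝓝 t] f ∨ splice a b f g =ᶠ[𝓝 t] g := by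
  rcases lt_or_gt_of_ne ha with h | h
  · left
    filter_upwards [Iio_mem_nhds h] with s hs
    exact splice_of_notMem fun h' => absurd h'.1 (not_lt.2 (le_of_lt hs))
  rcases lt_or_gt_of_ne hb with h' | h'
  · right
    filter_upwards [Ioo_mem_nhds h h'] with s hs
    exact splice_of_mem (Ioo_subset_Ioc_self hs)
  · left
    filter_upwards [Ioi_mem_nhds h'] with s hs
    exact splice_of_notMem fun h' => absurd h'.2 (not_le.2 hs)

theorem BddContOff.splice {T a b : ℝ} {D D' : Set ℝ} {f g : ℝ → E}
    (hf : BddContOff T D f) (hg : BddContOff T D' g) :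
    BddContOff T (D ∪ D' ∪ {a, b}) (splice a b f g) := by
  obtain ⟨⟨C, hC⟩, hf⟩ := hf
  obtain ⟨⟨C', hC'⟩, hg⟩ := hg
  refine ⟨⟨max C C', fun t ht => ?_⟩, fun t ht => ?_⟩
  · by_cases h : t ∈ Ioc a b
    · rw [splice_of_mem h]; exact (hC' t ht).trans (le_max_right _ _)
    · rw [splice_of_notMem h]; exact (hC t ht).trans (le_max_left _ _)
  · simp only [Set.mem_sdiff, mem_union, mem_insert_iff, mem_singleton_iff, not_or] at ht
    obtain ⟨h0, ⟨h1, h2⟩, h3, h4⟩ := ht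
    rcases splice_eventuallyEq f g h3 h4 with h | h
    · exact (hf t ⟨h0, h1⟩).congr h.symm
    · exact (hg t ⟨h0, h2⟩).congr h.symm

end BoundedContinuousOff

/-- Global existence for an initial value problem whose right-hand side is Lipschitz in the state
and has finitely many discontinuities in time, with a bound for the solution. -/
theorem exists_solution {X : Type*} [NormedAddCommGroup X] [NormedSpace ℝ X] [CompleteSpace X]
    [SecondCountableTopology X] {T K : ℝ} (hT : 0 < T) (hK : 0 < K) {D : Set ℝ} (hD : D.Finite)
    (F : ℝ → X → X)
    (hF : ∀ g : ℝ → X, Continuous g → BddContOff T D (fun t => F t (g t)))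
    (hLip : ∀ t ∈ Icc 0 T, ∀ x y, ‖F t x - F t y‖ ≤ K * ‖x - y‖) (y₀ : X) :
    ∃ y : ℝ → X, Continuous y ∧ y 0 = y₀ ∧
      (∀ t ∈ Ioo 0 T \ D, HasDerivAt y (F t (y t)) t) ∧
      ∀ B, (∀ t ∈ Icc 0 T, ‖y₀ + ∫ s in (0 : ℝ)..t, F s 0‖ ≤ B) →
        ∀ t ∈ Icc 0 T, ‖y t‖ ≤ 2 * B * Real.exp (2 * K * T) := by
  have h0T : (0 : ℝ) ∈ Icc 0 T := ⟨le_rfl, hT.le⟩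
  have hTT : T ∈ Icc 0 T := ⟨hT.le, le_rfl⟩
  have hint : ∀ g : ℝ → X, Continuous g → ∀ t ∈ Icc 0 T,
      IntervalIntegrable (fun s => F s (g s)) MeasureTheory.volume 0 t := fun g hg t ht =>
    (hF g hg).intervalIntegrable hD h0T ht
  let ext : C(Icc 0 T, X) → ℝ → X := fun z t => Real.exp (2 * K * t) • z (projIcc 0 T hT.le t)
  have hext : ∀ z, Continuous (ext z) := fun z =>
    (by fun_prop : Continuous fun t : ℝ => Real.exp (2 * K * t)).smul
      (z.continuous.comp continuous_projIcc)
  have hprim : ∀ z, ContinuousOn (fun t => ∫ s in (0 : ℝ)..t, F s (ext z s)) (Icc 0 T) := by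
    intro z
    have := intervalIntegral.continuousOn_primitive_interval'
      (hint _ (hext z) T hTT) (left_mem_uIcc)
    rwa [uIcc_of_le hT.le] at this
  let Φ : C(Icc 0 T, X) → C(Icc 0 T, X) := fun z =>
    ⟨fun t => Real.exp (-(2 * K * t)) • (y₀ + ∫ s in (0 : ℝ)..t, F s (ext z s)),
      (by fun_prop : Continuous fun t : Icc 0 T => Real.exp (-(2 * K * t))).smul
        (continuous_const.add (continuousOn_iff_continuous_domRestrict.1 (hprim z)))⟩
  have hΦ : ∀ z (t : Icc 0 T),
      Φ z t = Real.exp (-(2 * K * t)) • (y₀ + ∫ s in (0 : ℝ)..t, F s (ext z s)) :=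
    fun _ _ => rfl
  have hexp : ∀ (t : ℝ) (x : X), Real.exp (2 * K * t) • Real.exp (-(2 * K * t)) • x = x := by
    intro t x
    rw [smul_smul, ← Real.exp_add, add_neg_cancel, Real.exp_zero, one_smul]
  have hcontr : ContractingWith (1 / 2) Φ := by
    refine ⟨by rw [← NNReal.coe_lt_coe]; norm_num, LipschitzWith.of_dist_le_mul fun z z' => ?_⟩
    rw [ContinuousMap.dist_le (by positivity)]
    intro t
    rw [dist_eq_norm, hΦ, hΦ, ← smul_sub, add_sub_add_left_eq_sub,
      ← intervalIntegral.integral_sub (hint _ (hext z) t t.2) (hint _ (hext z') t t.2),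
      norm_smul, Real.norm_of_nonneg (Real.exp_pos _).le]
    have hb : ‖∫ s in (0 : ℝ)..t, (F s (ext z s) - F s (ext z' s))‖ ≤
        ∫ s in (0 : ℝ)..t, K * Real.exp (2 * K * s) * dist z z' := by
      refine intervalIntegral.norm_integral_le_of_norm_le t.2.1 (.of_forall fun s hs => ?_)
        (Continuous.intervalIntegrable (by fun_prop) _ _)
      refine (hLip s ⟨hs.1.le, hs.2.trans t.2.2⟩ _ _).trans ?_
      rw [mul_assoc]
      gcongr
      rw [← smul_sub, norm_smul, Real.norm_of_nonneg (Real.exp_pos _).le, ← dist_eq_norm]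
      gcongr
      exact ContinuousMap.dist_apply_le_dist _
    have hI : ∫ s in (0 : ℝ)..t, K * Real.exp (2 * K * s) * dist z z' =
        (Real.exp (2 * K * t) - 1) * (dist z z' / 2) := by
      rw [intervalIntegral.integral_eq_sub_of_hasDerivAt
        (f := fun s => Real.exp (2 * K * s) * (dist z z' / 2))
        (fun s _ => by
          have := (((hasDerivAt_id' s).const_mul (2 * K)).exp).mul_const (dist z z' / 2)
          exact this.congr_deriv (by ring)) (Continuous.intervalIntegrable (by fun_prop) _ _)]
      simp only [mul_zero, Real.exp_zero]
      ring
    calc _ ≤ Real.exp (-(2 * K * t)) * ((Real.exp (2 * K * t) - 1) * (dist z z' / 2)) := by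
          gcongr; exact hb.trans hI.le
      _ = (1 - Real.exp (-(2 * K * t))) * (dist z z' / 2) := by
          rw [← mul_assoc, mul_sub, ← Real.exp_add, neg_add_cancel, Real.exp_zero, mul_one]
      _ ≤ 1 * (dist z z' / 2) := by
          gcongr; linarith [Real.exp_pos (-(2 * K * t))]
      _ = _ := by simp; ring
  set z := ContractingWith.fixedPoint Φ hcontr with hz
  have hfix : Φ z = z := hcontr.fixedPoint_isFixedPt
  have hy : ∀ t ∈ Icc 0 T, ext z t = y₀ + ∫ s in (0 : ℝ)..t, F s (ext z s) := by
    intro t ht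
    have h1 := hΦ z ⟨t, ht⟩
    rw [hfix] at h1
    change Real.exp (2 * K * t) • z (projIcc 0 T hT.le t) = _
    rw [projIcc_of_mem hT.le ht, h1, hexp]
  refine ⟨ext z, hext z, by simpa using hy 0 h0T, fun t ht => ?_, fun B hB t ht => ?_⟩
  · have hcont := (hF _ (hext z)).2 t ht
    have h1 : HasDerivAt (fun u => ∫ s in (0 : ℝ)..u, F s (ext z s)) (F t (ext z t)) t := by
      refine intervalIntegral.integral_hasDerivAt_right
        (hint _ (hext z) t (Ioo_subset_Icc_self ht.1)) ⟨Ioc 0 T, Ioc_mem_nhds ht.1.1 ht.1.2, ?_⟩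
        hcont
      exact ((intervalIntegrable_iff_integrableOn_Ioc_of_le hT.le).1
        (hint _ (hext z) T hTT)).aestronglyMeasurable
    refine (h1.const_add y₀).congr_of_eventuallyEq ?_
    filter_upwards [Icc_mem_nhds ht.1.1 ht.1.2] with s hs using hy s hs
  · have hB0 : 0 ≤ B := (norm_nonneg _).trans (hB 0 h0T)
    have h1 : ‖Φ 0‖ ≤ B := by
      rw [ContinuousMap.norm_le _ hB0]
      intro s
      have h2 : ext 0 = fun _ => 0 := by ext s; simp [ext]
      rw [hΦ, norm_smul, Real.norm_of_nonneg (Real.exp_pos _).le, h2]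
      have h3 : Real.exp (-(2 * K * s)) ≤ 1 := by
        rw [Real.exp_le_one_iff]
        have := mul_nonneg hK.le s.2.1
        linarith
      calc _ ≤ 1 * B := mul_le_mul h3 (hB s s.2) (norm_nonneg _) zero_le_one
        _ = B := one_mul B
    have h4 : ‖z‖ ≤ 2 * B := by
      have := hcontr.dist_fixedPoint_le 0
      rw [← hz, dist_zero_left, dist_zero_left] at this
      refine this.trans ?_
      norm_num
      linarith
    calc ‖ext z t‖ = Real.exp (2 * K * t) * ‖z (projIcc 0 T hT.le t)‖ := by
          rw [norm_smul, Real.norm_of_nonneg (Real.exp_pos _).le]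
      _ ≤ Real.exp (2 * K * T) * (2 * B) := by
          gcongr
          · exact ht.2
          · exact (z.norm_coe_le_norm _).trans h4
      _ = _ := mul_comm _ _

/-- The radial retraction onto the unit ball. -/
noncomputable def unitRetract {X : Type*} [NormedAddCommGroup X] [NormedSpace ℝ X] (x : X) : X :=
  (max 1 ‖x‖)⁻¹ • x

section unitRetract

variable {X : Type*} [NormedAddCommGroup X] [NormedSpace ℝ X]

theorem unitRetract_of_norm_le {x : X} (h : ‖x‖ ≤ 1) : unitRetract x = x := by
  simp [unitRetract, max_eq_left h]

theorem norm_unitRetract_le (x : X) : ‖unitRetract x‖ ≤ 1 := by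
  have h : 0 < max 1 ‖x‖ := lt_max_of_lt_left one_pos
  rw [unitRetract, norm_smul, norm_inv, Real.norm_of_nonneg h.le, inv_mul_le_one₀ h]
  exact le_max_right _ _

theorem norm_unitRetract_sub_le (x y : X) :
    ‖unitRetract x - unitRetract y‖ ≤ 2 * ‖x - y‖ := by
  set m := max 1 ‖x‖ with hm
  set n := max 1 ‖y‖ with hn
  have hm1 : 1 ≤ m := le_max_left _ _
  have hn1 : 1 ≤ n := le_max_left _ _
  have hmn : |n - m| ≤ ‖x - y‖ := by
    refine (abs_max_sub_max_le_max _ _ _ _).trans ?_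
    rw [sub_self, abs_zero, max_eq_right (abs_nonneg _), norm_sub_rev]
    exact abs_norm_sub_norm_le _ _
  have hyn : ‖y‖ ≤ n := le_max_right _ _
  have h : unitRetract x - unitRetract y = m⁻¹ • (x - y) + (m⁻¹ * (n - m)) • n⁻¹ • y := by
    have h1 : m⁻¹ * (n - m) * n⁻¹ = m⁻¹ - n⁻¹ := by field_simp
    rw [smul_smul, h1, sub_smul, smul_sub]
    simp only [unitRetract, ← hm, ← hn]
    abel
  have hmi : m⁻¹ ≤ 1 := inv_le_one_of_one_le₀ hm1
  have hmi0 : 0 ≤ m⁻¹ := by positivity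
  have hu : ‖n⁻¹ • y‖ ≤ 1 := norm_unitRetract_le y
  rw [h]
  refine (norm_add_le _ _).trans ?_
  rw [norm_smul, norm_smul, norm_mul, Real.norm_of_nonneg hmi0, Real.norm_eq_abs]
  calc _ ≤ 1 * ‖x - y‖ + 1 * ‖x - y‖ * 1 := by gcongr
    _ = _ := by ring

theorem continuous_unitRetract : Continuous (unitRetract : X → X) :=
  (LipschitzWith.of_dist_le_mul (K := 2) fun x y => by
    simpa [dist_eq_norm] using norm_unitRetract_sub_le x y).continuous

end unitRetract

section LocalBounds

variable {V W : Type*} [NormedAddCommGroup V] [NormedSpace ℝ V] [ProperSpace V]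
  [NormedAddCommGroup W] [NormedSpace ℝ W]

theorem exists_lipschitz_bound {F : V → W} (hF : ContDiff ℝ 1 F) (R : ℝ) :
    ∃ L, 0 ≤ L ∧ ∀ u v, ‖u‖ ≤ R → ‖v‖ ≤ R → ‖F u - F v‖ ≤ L * ‖u - v‖ := by
  obtain ⟨L, hL⟩ := (hF.locallyLipschitz.locallyLipschitzOn
    (s := Metric.closedBall 0 R)).exists_lipschitzOnWith_of_compact (isCompact_closedBall 0 R)
  refine ⟨L, L.2, fun u v hu hv => ?_⟩
  simpa [dist_eq_norm] using hL.dist_le_mul u (by simpa using hu) v (by simpa using hv)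

theorem exists_taylor_bound {F : V → W} (hF : ContDiff ℝ 2 F) (R : ℝ) :
    ∃ C, 0 ≤ C ∧ ∀ u v, ‖u‖ ≤ R → ‖v‖ ≤ R →
      ‖F v - F u - fderiv ℝ F u (v - u)‖ ≤ C * ‖v - u‖ ^ 2 := by
  obtain ⟨C, hC0, hC⟩ := exists_lipschitz_bound
    (hF.fderiv_right (m := 1) (by norm_num)) R
  refine ⟨C, hC0, fun u v hu hv => ?_⟩
  have hsub : segment ℝ u v ⊆ Metric.closedBall (0 : V) R :=
    (convex_closedBall 0 R).segment_subset (by simpa using hu) (by simpa using hv)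
  have h := Convex.norm_image_sub_le_of_norm_hasFDerivWithin_le' (s := segment ℝ u v)
    (f := F) (f' := fderiv ℝ F) (φ := fderiv ℝ F u) (C := C * ‖v - u‖)
    (fun z _ => ((hF.differentiable (by norm_num)) z).hasFDerivAt.hasFDerivWithinAt)
    (fun z hz => ?_) (convex_segment u v) (left_mem_segment ℝ u v) (right_mem_segment ℝ u v)
  · rwa [mul_assoc, ← sq] at h
  · refine (hC z u (by simpa using hsub hz) hu).trans ?_
    gcongr
    obtain ⟨a, b, ha, hb, hab, rfl⟩ := hz
    have : a • u + b • v - u = b • (v - u) := by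
      rw [eq_sub_of_add_eq hab]; module
    rw [this, norm_smul, Real.norm_of_nonneg hb]
    exact mul_le_of_le_one_left (norm_nonneg _) (by linarith)

end LocalBounds

theorem BddContOff.reverse {E : Type*} [NormedAddCommGroup E] {T : ℝ} {D : Set ℝ} {g : ℝ → E}
    (hg : BddContOff T D g) :
    BddContOff T ((fun t => T - t) ⁻¹' D) (fun t => g (T - t)) := by
  obtain ⟨⟨C, hC⟩, hg⟩ := hg
  refine ⟨⟨C, fun t ht => hC _ ⟨by linarith [ht.2], by linarith [ht.1]⟩⟩, fun t ht => ?_⟩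
  exact ContinuousAt.comp (f := fun t => T - t)
    (hg _ ⟨⟨by linarith [ht.1.2], by linarith [ht.1.1]⟩, ht.2⟩) (by fun_prop)

/-- An integral bound for a function that is at most `A` on `(a, a + ε]` and at most `B`
elsewhere. -/
theorem integral_le_of_le_on_needle {T a ε A B : ℝ} {g : ℝ → ℝ} (ha : 0 ≤ a) (hε : 0 ≤ ε)
    (haT : a + ε ≤ T) (hg : ∀ s ∈ Icc 0 T, ∀ t ∈ Icc 0 T,
      IntervalIntegrable g MeasureTheory.volume s t)
    (hA : ∀ s ∈ Ioc a (a + ε), g s ≤ A)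
    (hB : ∀ s ∈ Icc 0 T, s ∉ Ioc a (a + ε) → g s ≤ B) :
    ∫ s in (0 : ℝ)..T, g s ≤ A * ε + B * (T - ε) := by
  have m0 : (0 : ℝ) ∈ Icc 0 T := ⟨le_rfl, by linarith⟩
  have m1 : a ∈ Icc 0 T := ⟨ha, by linarith⟩
  have m2 : a + ε ∈ Icc 0 T := ⟨by linarith, haT⟩
  have m3 : T ∈ Icc 0 T := ⟨by linarith, le_rfl⟩
  have key : ∀ (u v c : ℝ), u ∈ Icc 0 T → v ∈ Icc 0 T → u ≤ v → (∀ s ∈ Ioo u v, g s ≤ c) →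
      ∫ s in u..v, g s ≤ (v - u) * c := by
    intro u v c hu hv huv h
    have := intervalIntegral.integral_mono_on_of_le_Ioo huv (hg u hu v hv)
      (intervalIntegrable_const (c := c)) h
    simpa using this
  have i1 := key 0 a B m0 m1 ha fun s hs =>
    hB s ⟨hs.1.le, by linarith [hs.2]⟩ fun h => absurd h.1 (not_lt.2 hs.2.le)
  have i2 := key a (a + ε) A m1 m2 (by linarith) fun s hs => hA s ⟨hs.1, hs.2.le⟩
  have i3 := key (a + ε) T B m2 m3 haT fun s hs =>
    hB s ⟨by linarith [hs.1], hs.2.le⟩ fun h => absurd h.2 (not_le.2 hs.1)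
  rw [← intervalIntegral.integral_add_adjacent_intervals (hg 0 m0 (a + ε) m2) (hg _ m2 T m3),
    ← intervalIntegral.integral_add_adjacent_intervals (hg 0 m0 a m1) (hg a m1 _ m2)]
  linarith

section MaximumPrinciple

variable {Θ X : Type*} [NormedAddCommGroup Θ] [NormedSpace ℝ Θ]
  [NormedAddCommGroup X] [NormedSpace ℝ X]

/-- The partial derivative in the second variable. -/
noncomputable def fderivSnd {W : Type*} [NormedAddCommGroup W] [NormedSpace ℝ W]
    (F : Θ × X → W) (q : Θ × X) : X →L[ℝ] W :=
  (fderiv ℝ F q).comp (ContinuousLinearMap.inr ℝ Θ X)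

theorem continuous_fderivSnd {W : Type*} [NormedAddCommGroup W] [NormedSpace ℝ W]
    {F : Θ × X → W} (hF : ContDiff ℝ 2 F) : Continuous (fderivSnd F) :=
  (hF.continuous_fderiv (by norm_num)).clm_comp continuous_const

/-- The derivative in the state of the Hamiltonian `ℓ + p f`. -/
noncomputable def hamiltonianGrad (f : Θ × X → X) (ℓ : Θ × X → ℝ) (q : Θ × X)
    (p : X →L[ℝ] ℝ) : X →L[ℝ] ℝ :=
  fderivSnd ℓ q + p.comp (fderivSnd f q)

variable [FiniteDimensional ℝ Θ] [FiniteDimensional ℝ X]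
  {f : Θ × X → X} {ℓ : Θ × X → ℝ} {T : ℝ} {D D' : Set ℝ} {θ η : ℝ → Θ} {x : ℝ → X}

theorem BddContOff.hamiltonianGrad (hf : ContDiff ℝ 2 f) (hℓ : ContDiff ℝ 2 ℓ)
    (hθ : BddContOff T D θ) (hx : BddContOff T D x) {p : ℝ → X →L[ℝ] ℝ}
    (hp : BddContOff T D p) :
    BddContOff T D (fun t => hamiltonianGrad f ℓ (θ t, x t) (p t)) := by
  have h : Continuous fun z : (Θ × X) × (X →L[ℝ] ℝ) => PPAC.hamiltonianGrad f ℓ z.1 z.2 :=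
    ((continuous_fderivSnd hℓ).comp continuous_fst).add
      (continuous_snd.clm_comp ((continuous_fderivSnd hf).comp continuous_fst))
  exact ((hθ.prodMk hx).prodMk hp).comp h

/-- The adjoint equation has a solution that vanishes at time `T`. -/
theorem exists_adjoint (hf : ContDiff ℝ 2 f) (hℓ : ContDiff ℝ 2 ℓ) (hT : 0 < T) (hD : D.Finite)
    (hθ : BddContOff T D θ) (hx : BddContOff T D x) :
    ∃ p : ℝ → X →L[ℝ] ℝ, Continuous p ∧ p T = 0 ∧ ∀ t ∈ Ioo 0 T \ D,
      HasDerivAt p (-hamiltonianGrad f ℓ (θ t, x t) (p t)) t := by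
  obtain ⟨C, hC⟩ := ((hθ.prodMk hx).comp (continuous_fderivSnd hf)).1
  have hC0 : 0 ≤ C := (norm_nonneg _).trans (hC 0 ⟨le_rfl, hT.le⟩)
  obtain ⟨q, hqc, hq0, hq, -⟩ := exists_solution (X := X →L[ℝ] ℝ) hT
    (by linarith : 0 < C + 1) (hD.preimage (f := fun t => T - t) sub_right_injective.injOn)
    (fun t q => hamiltonianGrad f ℓ (θ (T - t), x (T - t)) q)
    (fun g hg => by
      have h1 : Continuous fun t => g (T - t) := by fun_prop
      simpa using (BddContOff.hamiltonianGrad hf hℓ hθ hx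
        (BddContOff.of_continuousOn h1.continuousOn)).reverse)
    (fun t ht p p' => by
      simp only [hamiltonianGrad, add_sub_add_left_eq_sub, ← ContinuousLinearMap.sub_comp]
      refine (ContinuousLinearMap.opNorm_comp_le _ _).trans ?_
      rw [mul_comm]
      gcongr
      exact (hC _ ⟨by linarith [ht.2], by linarith [ht.1]⟩).trans (by linarith))
    0
  refine ⟨fun t => q (T - t), by fun_prop, by simpa using hq0, fun t ht => ?_⟩
  have h := hq (T - t) ⟨⟨by linarith [ht.1.2], by linarith [ht.1.1]⟩, by simpa using ht.2⟩
  simpa using HasDerivAt.comp_const_sub T t h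

/-- The trajectory of a control that is modified on a short interval exists on `[0, T]` and differs
from the reference trajectory by at most a multiple of the length of that interval. -/
theorem exists_perturbed_trajectory (hf : ContDiff ℝ 2 f) (hT : 0 < T) (hD : D.Finite)
    (hD' : D'.Finite) (hθ : BddContOff T D θ) (hη : BddContOff T D' η)
    (hx : ContinuousOn x (Icc 0 T)) {a : ℝ} (ha : 0 ≤ a) :
    ∃ C, 0 ≤ C ∧ ∀ ε, 0 < ε → a + ε ≤ T → C * ε ≤ 1 →
      ∃ y : ℝ → X, Continuous y ∧ y 0 = 0 ∧ (∀ t ∈ Icc 0 T, ‖y t‖ ≤ C * ε) ∧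
        ∀ t ∈ Ioo 0 T \ (D ∪ D' ∪ {a, a + ε}), HasDerivAt y
          (f (splice a (a + ε) θ η t, x t + y t) - f (θ t, x t)) t := by
  have hxb : BddContOff T ∅ x := BddContOff.of_continuousOn hx
  obtain ⟨Cθ, hCθ⟩ := hθ.1
  obtain ⟨Cη, hCη⟩ := hη.1
  obtain ⟨Cx, hCx⟩ := hxb.1
  set R := max (max Cθ Cη) (Cx + 1) with hR
  have hR0 : 0 ≤ R := ((norm_nonneg _).trans (hCθ 0 ⟨le_rfl, hT.le⟩)).trans
    ((le_max_left _ _).trans (le_max_left _ _))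
  have bθ : ∀ t ∈ Icc 0 T, ‖θ t‖ ≤ R := fun t ht =>
    (hCθ t ht).trans ((le_max_left _ _).trans (le_max_left _ _))
  have bη : ∀ t ∈ Icc 0 T, ‖η t‖ ≤ R := fun t ht =>
    (hCη t ht).trans ((le_max_right _ _).trans (le_max_left _ _))
  have bx : ∀ t ∈ Icc 0 T, ∀ z : X, ‖z‖ ≤ 1 → ‖x t + z‖ ≤ R := fun t ht z hz =>
    (norm_add_le _ _).trans ((add_le_add (hCx t ht) hz).trans (le_max_right _ _))
  have bs : ∀ b, ∀ t ∈ Icc 0 T, ‖splice a b θ η t‖ ≤ R := fun b t ht => by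
    by_cases h : t ∈ Ioc a b
    · rw [splice_of_mem h]; exact bη t ht
    · rw [splice_of_notMem h]; exact bθ t ht
  obtain ⟨L, hL0, hL⟩ := exists_lipschitz_bound (hf.of_le (by norm_num : (1 : WithTop ℕ∞) ≤ 2)) R
  have hK : 0 < 2 * L + 1 := by linarith
  set Z := Real.exp (2 * (2 * L + 1) * T) with hZ
  refine ⟨2 * (L * (2 * R)) * Z, by positivity, fun ε hε haε hCε => ?_⟩
  set θε := splice a (a + ε) θ η with hθε
  have hθεb : BddContOff T (D ∪ D' ∪ {a, a + ε}) θε := hθ.splice hη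
  have hDD : (D ∪ D' ∪ {a, a + ε}).Finite := (hD.union hD').union (toFinite _)
  have hFb : ∀ g : ℝ → X, Continuous g → BddContOff T (D ∪ D' ∪ {a, a + ε})
      (fun t => f (θε t, x t + unitRetract (g t)) - f (θ t, x t)) := by
    intro g hg
    have h1 := (hθεb.prodMk (hθ.mono (subset_union_left.trans subset_union_left))).prodMk
      ((hxb.mono (empty_subset _)).prodMk (BddContOff.of_continuousOn hg.continuousOn))
    refine h1.comp (φ := fun z : (Θ × Θ) × X × X =>
      f (z.1.1, z.2.1 + unitRetract z.2.2) - f (z.1.2, z.2.1)) ?_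
    have := hf.continuous
    have := continuous_unitRetract (X := X)
    fun_prop
  obtain ⟨y, hyc, hy0, hy, hyb⟩ := exists_solution hT hK hDD
    (fun t z => f (θε t, x t + unitRetract z) - f (θ t, x t)) hFb
    (fun t ht z z' => by
      rw [sub_sub_sub_cancel_right]
      have h1 := hL (θε t, x t + unitRetract z) (θε t, x t + unitRetract z')
        (max_le (bs _ t ht) (bx t ht _ (norm_unitRetract_le z)))
        (max_le (bs _ t ht) (bx t ht _ (norm_unitRetract_le z')))
      rw [Prod.mk_sub_mk, sub_self, add_sub_add_left_eq_sub, Prod.norm_mk, norm_zero,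
        max_eq_right (norm_nonneg _)] at h1
      have h2 := norm_unitRetract_sub_le z z'
      nlinarith [norm_nonneg (z - z')])
    0
  have hmain : ∀ t ∈ Icc 0 T, ‖y t‖ ≤ 2 * (L * (2 * R)) * Z * ε := by
    intro t ht
    have hint : ∀ s ∈ Icc 0 T, ∀ t ∈ Icc 0 T, IntervalIntegrable
        (fun s => ‖f (θε s, x s + unitRetract 0) - f (θ s, x s)‖) MeasureTheory.volume s t :=
      fun s hs t ht => ((hFb (fun _ => 0) continuous_const).intervalIntegrable hDD hs ht).norm
    have h := hyb (L * (2 * R) * ε) (fun t ht => ?_) t ht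
    · exact h.trans (by rw [← hZ]; linarith)
    · rw [zero_add]
      calc _ ≤ ∫ s in (0 : ℝ)..t, ‖f (θε s, x s + unitRetract 0) - f (θ s, x s)‖ :=
            intervalIntegral.norm_integral_le_integral_norm ht.1
        _ ≤ ∫ s in (0 : ℝ)..T, ‖f (θε s, x s + unitRetract 0) - f (θ s, x s)‖ :=
            intervalIntegral.integral_mono_interval le_rfl ht.1 ht.2
              (.of_forall fun s => norm_nonneg _)
              (hint 0 ⟨le_rfl, hT.le⟩ T ⟨hT.le, le_rfl⟩)
        _ ≤ L * (2 * R) * ε + 0 * (T - ε) := by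
            refine integral_le_of_le_on_needle ha hε.le haε hint (fun s hs => ?_)
              (fun s hs hs' => ?_)
            · have hs' : s ∈ Icc 0 T := ⟨ha.trans hs.1.le, hs.2.trans haε⟩
              have h0 : unitRetract (0 : X) = 0 := unitRetract_of_norm_le (by simp)
              have hxs : ‖x s‖ ≤ R := by simpa using bx s hs' 0 (by simp)
              rw [hθε, splice_of_mem hs, h0, add_zero]
              refine (hL _ _ (max_le (bη s hs') hxs) (max_le (bθ s hs') hxs)).trans ?_
              rw [Prod.mk_sub_mk, sub_self, Prod.norm_mk, norm_zero,
                max_eq_left (norm_nonneg _)]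
              gcongr
              exact (norm_sub_le _ _).trans (by linarith [bη s hs', bθ s hs'])
            · have h0 : unitRetract (0 : X) = 0 := unitRetract_of_norm_le (by simp)
              rw [hθε, splice_of_notMem hs', h0, add_zero, sub_self, norm_zero]
        _ = L * (2 * R) * ε := by ring
  refine ⟨y, hyc, hy0, hmain, fun t ht => ?_⟩
  have := hy t ht
  rwa [unitRetract_of_norm_le ((hmain t (Ioo_subset_Icc_self ht.1)).trans hCε)] at this

/-- The cost difference of two trajectories is the integral of the difference between the increment
of the Hamiltonian and its linear part. -/
theorem integral_cost_sub_eq (hf : ContDiff ℝ 2 f) (hℓ : ContDiff ℝ 2 ℓ) (hT : 0 < T)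
    (hD : D.Finite) (hθ : BddContOff T D θ) (hη : BddContOff T D η)
    (hx : ContinuousOn x (Icc 0 T)) {p : ℝ → X →L[ℝ] ℝ} (hpc : Continuous p) (hpT : p T = 0)
    (hp : ∀ t ∈ Ioo 0 T \ D, HasDerivAt p (-hamiltonianGrad f ℓ (θ t, x t) (p t)) t)
    {y : ℝ → X} (hyc : Continuous y) (hy0 : y 0 = 0)
    (hy : ∀ t ∈ Ioo 0 T \ D, HasDerivAt y (f (η t, x t + y t) - f (θ t, x t)) t)
    {r : ℝ → ℝ} (hr : r = fun t => (ℓ (η t, x t + y t) - ℓ (θ t, x t)) +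
      (p t (f (η t, x t + y t) - f (θ t, x t)) - hamiltonianGrad f ℓ (θ t, x t) (p t) (y t))) :
    BddContOff T D r ∧
    (∫ t in (0 : ℝ)..T, ℓ (η t, x t + y t)) - ∫ t in (0 : ℝ)..T, ℓ (θ t, x t) =
      ∫ t in (0 : ℝ)..T, r t := by
  have m0 : (0 : ℝ) ∈ Icc 0 T := ⟨le_rfl, hT.le⟩
  have mT : T ∈ Icc 0 T := ⟨hT.le, le_rfl⟩
  have hxb : BddContOff T D x := BddContOff.of_continuousOn hx
  have hyb : BddContOff T D y := BddContOff.of_continuousOn hyc.continuousOn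
  have hpb : BddContOff T D p := BddContOff.of_continuousOn hpc.continuousOn
  have hgrad := BddContOff.hamiltonianGrad hf hℓ hθ hxb hpb
  have hfc := hf.continuous
  have hℓc := hℓ.continuous
  have hall := (hθ.prodMk hη).prodMk (hxb.prodMk (hyb.prodMk (hpb.prodMk hgrad)))
  have b1 : BddContOff T D (fun t => ℓ (η t, x t + y t)) := hall.comp
    (φ := fun z : (Θ × Θ) × X × X × (X →L[ℝ] ℝ) × (X →L[ℝ] ℝ) => ℓ (z.1.2, z.2.1 + z.2.2.1))
    (by fun_prop)
  have b2 : BddContOff T D (fun t => ℓ (θ t, x t)) := hall.comp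
    (φ := fun z : (Θ × Θ) × X × X × (X →L[ℝ] ℝ) × (X →L[ℝ] ℝ) => ℓ (z.1.1, z.2.1))
    (by fun_prop)
  have b3 : BddContOff T D (fun t => p t (f (η t, x t + y t) - f (θ t, x t)) -
      hamiltonianGrad f ℓ (θ t, x t) (p t) (y t)) := hall.comp
    (φ := fun z : (Θ × Θ) × X × X × (X →L[ℝ] ℝ) × (X →L[ℝ] ℝ) =>
      z.2.2.2.1 (f (z.1.2, z.2.1 + z.2.2.1) - f (z.1.1, z.2.1)) - z.2.2.2.2 z.2.2.1)
    (by fun_prop)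
  have hrb : BddContOff T D r := by
    rw [hr]
    exact ((b1.prodMk b2).prodMk b3).comp (φ := fun z : (ℝ × ℝ) × ℝ => (z.1.1 - z.1.2) + z.2)
      (by fun_prop)
  refine ⟨hrb, ?_⟩
  have j1 := b1.intervalIntegrable hD m0 mT
  have j2 := b2.intervalIntegrable hD m0 mT
  have j3 := b3.intervalIntegrable hD m0 mT
  have hparts := MeasureTheory.integral_eq_of_hasDerivAt_off_countable_of_le
    (fun t => p t (y t)) _ hT.le hD.countable (hpc.clm_apply hyc).continuousOn
    (fun t ht => by
      have h := (hp t ht).clm_apply (hy t ht)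
      rw [neg_apply, neg_add_eq_sub] at h
      exact h) j3
  rw [hpT, hy0, map_zero, zero_apply, sub_zero] at hparts
  rw [← intervalIntegral.integral_sub j1 j2, hr,
    intervalIntegral.integral_add (j1.sub j2) j3, hparts, add_zero]

/-- The maximum principle: if no needle variation of the control `θ` towards `η` at time `a`
lowers the cost, then the Hamiltonian at `a` is not lowered by replacing `θ` by `η`. -/
theorem hamiltonian_le_of_needle (hf : ContDiff ℝ 2 f) (hℓ : ContDiff ℝ 2 ℓ) (hT : 0 < T)
    (hD : D.Finite) (hD' : D'.Finite) (hθ : BddContOff T D θ) (hη : BddContOff T D' η)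
    (hx : ContinuousOn x (Icc 0 T))
    (hxd : ∀ t ∈ Ioo 0 T \ D, HasDerivAt x (f (θ t, x t)) t)
    {p : ℝ → X →L[ℝ] ℝ} (hpc : Continuous p) (hpT : p T = 0)
    (hp : ∀ t ∈ Ioo 0 T \ D, HasDerivAt p (-hamiltonianGrad f ℓ (θ t, x t) (p t)) t)
    {a : ℝ} (ha : a ∈ Ioo 0 T \ (D ∪ D'))
    (hopt : ∀ ε > 0, a + ε ≤ T → ∀ (D'' : Set ℝ) (x' : ℝ → X), D''.Finite →
      ContinuousOn x' (Icc 0 T) → x' 0 = x 0 →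
      (∀ t ∈ Ioo 0 T \ D'', HasDerivAt x' (f (splice a (a + ε) θ η t, x' t)) t) →
      ∫ t in (0 : ℝ)..T, ℓ (θ t, x t) ≤
        ∫ t in (0 : ℝ)..T, ℓ (splice a (a + ε) θ η t, x' t)) :
    ℓ (θ a, x a) + p a (f (θ a, x a)) ≤ ℓ (η a, x a) + p a (f (η a, x a)) := by
  obtain ⟨⟨ha0, haT⟩, haD⟩ := ha
  rw [mem_union, not_or] at haD
  have hxb : BddContOff T ∅ x := BddContOff.of_continuousOn hx
  have hpb : BddContOff T ∅ p := BddContOff.of_continuousOn hpc.continuousOn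
  have hgb := BddContOff.hamiltonianGrad hf hℓ hθ (hxb.mono (empty_subset _))
    (hpb.mono (empty_subset _))
  obtain ⟨C, hC0, hC⟩ := exists_perturbed_trajectory hf hT hD hD' hθ hη hx ha0.le
  obtain ⟨Cθ, hCθ⟩ := hθ.1
  obtain ⟨Cη, hCη⟩ := hη.1
  obtain ⟨Cx, hCx⟩ := hxb.1
  obtain ⟨Cp, hCp⟩ := hpb.1
  obtain ⟨Cg, hCg⟩ := hgb.1
  have m0 : (0 : ℝ) ∈ Icc 0 T := ⟨le_rfl, hT.le⟩
  have hCp0 : 0 ≤ Cp := (norm_nonneg _).trans (hCp 0 m0)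
  have hCg0 : 0 ≤ Cg := (norm_nonneg _).trans (hCg 0 m0)
  set R := max (max Cθ Cη) (Cx + 1) with hR
  have bθ : ∀ t ∈ Icc 0 T, ‖θ t‖ ≤ R := fun t ht =>
    (hCθ t ht).trans ((le_max_left _ _).trans (le_max_left _ _))
  have bη : ∀ t ∈ Icc 0 T, ‖η t‖ ≤ R := fun t ht =>
    (hCη t ht).trans ((le_max_right _ _).trans (le_max_left _ _))
  have bx : ∀ t ∈ Icc 0 T, ∀ z : X, ‖z‖ ≤ 1 → ‖x t + z‖ ≤ R := fun t ht z hz =>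
    (norm_add_le _ _).trans ((add_le_add (hCx t ht) hz).trans (le_max_right _ _))
  have bx0 : ∀ t ∈ Icc 0 T, ‖x t‖ ≤ R := fun t ht => by simpa using bx t ht 0 (by simp)
  obtain ⟨Lf, hLf0, hLf⟩ := exists_lipschitz_bound (hf.of_le (by norm_num : (1 : WithTop ℕ∞) ≤ 2)) R
  obtain ⟨Ll, hLl0, hLl⟩ := exists_lipschitz_bound (hℓ.of_le (by norm_num : (1 : WithTop ℕ∞) ≤ 2)) R
  obtain ⟨Qf, hQf0, hQf⟩ := exists_taylor_bound hf R
  obtain ⟨Ql, hQl0, hQl⟩ := exists_taylor_bound hℓ R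
  have pbound : ∀ t ∈ Icc 0 T, ∀ v : X, |p t v| ≤ Cp * ‖v‖ := fun t ht v =>
    ((p t).le_opNorm v).trans (by gcongr; exact hCp t ht)
  by_contra! hlt
  set gap : ℝ → ℝ := fun t => (ℓ (η t, x t) + p t (f (η t, x t))) -
    (ℓ (θ t, x t) + p t (f (θ t, x t))) with hgap
  have hgapc : ContinuousAt gap a := by
    have h := (((hθ.2 a ⟨⟨ha0, haT⟩, haD.1⟩).prodMk (hη.2 a ⟨⟨ha0, haT⟩, haD.2⟩)).prodMk
      ((hxb.2 a ⟨⟨ha0, haT⟩, by simp⟩).prodMk hpc.continuousAt))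
    have hfc := hf.continuous
    have hℓc := hℓ.continuous
    exact ContinuousAt.comp (g := fun z : (Θ × Θ) × X × (X →L[ℝ] ℝ) =>
      (ℓ (z.1.2, z.2.1) + z.2.2 (f (z.1.2, z.2.1))) -
        (ℓ (z.1.1, z.2.1) + z.2.2 (f (z.1.1, z.2.1)))) (by fun_prop) h
  obtain ⟨c, hc0, hc⟩ : ∃ c > 0, gap a < -c :=
    ⟨-gap a / 2, by simp only [hgap]; linarith, by simp only [hgap]; linarith⟩
  obtain ⟨d, hd0, hd⟩ := Metric.eventually_nhds_iff.1 (hgapc.eventually_lt_const hc)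
  set M₁ := (Ll + Cp * Lf + Cg) * C with hM₁
  set M₂ := (Ql + Cp * Qf) * C ^ 2 with hM₂
  have hM₁0 : 0 ≤ M₁ := by positivity
  have hM₂0 : 0 ≤ M₂ := by positivity
  obtain ⟨ε, hε0, hεd, hεT, hεC, hεM⟩ : ∃ ε > 0, ε < d ∧ a + ε ≤ T ∧ C * ε ≤ 1 ∧
      (M₁ + M₂ * T) * ε < c := by
    have e1 : ∀ᶠ ε in 𝓝[>] (0 : ℝ), ε < d := (eventually_lt_nhds hd0).filter_mono inf_le_left
    have e2 : ∀ᶠ ε in 𝓝[>] (0 : ℝ), ε < T - a :=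
      (eventually_lt_nhds (sub_pos.2 haT)).filter_mono inf_le_left
    have e3 : ∀ K : ℝ, ∀ b > 0, ∀ᶠ ε in 𝓝[>] (0 : ℝ), K * ε < b := fun K b hb =>
      ((by fun_prop : Continuous fun ε : ℝ => K * ε).continuousAt.eventually_lt_const
        (by simpa using hb)).filter_mono inf_le_left
    obtain ⟨ε, ⟨⟨h1, h2⟩, h3, h4⟩, h5⟩ := (((e1.and e2).and ((e3 C 1 one_pos).and
      (e3 (M₁ + M₂ * T) c hc0))).and self_mem_nhdsWithin).exists
    exact ⟨ε, h5, h1, by linarith, h3.le, h4⟩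
  obtain ⟨y, hyc, hy0, hyb, hyd⟩ := hC ε hε0 hεT hεC
  have hDD : (D ∪ D' ∪ {a, a + ε}).Finite := (hD.union hD').union (toFinite _)
  have hsub : D ⊆ D ∪ D' ∪ {a, a + ε} := subset_union_left.trans subset_union_left
  have hnot : ∀ t ∈ Ioo 0 T \ (D ∪ D' ∪ {a, a + ε}), t ∈ Ioo 0 T \ D :=
    fun t ht => ⟨ht.1, fun h => ht.2 (hsub h)⟩
  obtain ⟨hrb, hint⟩ := integral_cost_sub_eq hf hℓ hT hDD (hθ.mono hsub) (hθ.splice hη) hx hpc hpT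
    (fun t ht => hp t (hnot t ht)) hyc hy0 hyd rfl
  have hle := hopt ε hε0 hεT _ (fun t => x t + y t) hDD (hx.add hyc.continuousOn)
    (by simp [hy0]) (fun t ht => ((hxd t (hnot t ht)).fun_add (hyd t ht)).congr_deriv (by abel))
  have hupper := integral_le_of_le_on_needle (A := -c + M₁ * ε) (B := M₂ * ε ^ 2) ha0.le hε0.le hεT
    (fun s hs t ht => hrb.intervalIntegrable hDD hs ht)
    (fun s hs => by
      have hs' : s ∈ Icc 0 T := ⟨ha0.le.trans hs.1.le, hs.2.trans hεT⟩
      have hy1 := hyb s hs'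
      have hg : gap s < -c := hd (by
        rw [Real.dist_eq, abs_of_pos (sub_pos.2 hs.1)]; linarith [hs.2])
      have h1 := hLl (η s, x s + y s) (η s, x s)
        (max_le (bη s hs') (bx s hs' _ (hy1.trans hεC))) (max_le (bη s hs') (bx0 s hs'))
      have h2 := hLf (η s, x s + y s) (η s, x s)
        (max_le (bη s hs') (bx s hs' _ (hy1.trans hεC))) (max_le (bη s hs') (bx0 s hs'))
      rw [Prod.mk_sub_mk, sub_self, add_sub_cancel_left, Prod.norm_mk, norm_zero,
        max_eq_right (norm_nonneg _)] at h1 h2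
      have h3 := pbound s hs' (f (η s, x s + y s) - f (η s, x s))
      have h4 : |hamiltonianGrad f ℓ (θ s, x s) (p s) (y s)| ≤ Cg * ‖y s‖ :=
        ((hamiltonianGrad f ℓ (θ s, x s) (p s)).le_opNorm _).trans
          (by gcongr; exact hCg s hs')
      have h5 : Cp * ‖f (η s, x s + y s) - f (η s, x s)‖ ≤ Cp * (Lf * ‖y s‖) := by gcongr
      have h6 : (Ll + Cp * Lf + Cg) * ‖y s‖ ≤ (Ll + Cp * Lf + Cg) * (C * ε) := by gcongr
      rw [Real.norm_eq_abs] at h1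
      rw [map_sub] at h3
      simp only [hgap] at hg
      simp only [splice_of_mem hs, map_sub]
      have h7 := (le_abs_self _).trans h1
      have h8 := (le_abs_self _).trans h3
      have h9 := (neg_le_abs _).trans h4
      rw [hM₁]
      linarith)
    (fun s hs' hs => by
      have hy1 := hyb s hs'
      have h1 := hQl (θ s, x s) (θ s, x s + y s) (max_le (bθ s hs') (bx0 s hs'))
        (max_le (bθ s hs') (bx s hs' _ (hy1.trans hεC)))
      have h2 := hQf (θ s, x s) (θ s, x s + y s) (max_le (bθ s hs') (bx0 s hs'))
        (max_le (bθ s hs') (bx s hs' _ (hy1.trans hεC)))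
      rw [Prod.mk_sub_mk, sub_self, add_sub_cancel_left, Prod.norm_mk, norm_zero,
        max_eq_right (norm_nonneg _)] at h1 h2
      have h3 := pbound s hs' (f (θ s, x s + y s) - f (θ s, x s) - fderiv ℝ f (θ s, x s) (0, y s))
      have h5 : Cp * ‖f (θ s, x s + y s) - f (θ s, x s) - fderiv ℝ f (θ s, x s) (0, y s)‖ ≤
        Cp * (Qf * ‖y s‖ ^ 2) := by gcongr
      have h6 : (Ql + Cp * Qf) * ‖y s‖ ^ 2 ≤ (Ql + Cp * Qf) * (C * ε) ^ 2 := by gcongr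
      rw [Real.norm_eq_abs] at h1
      have h7 := (le_abs_self _).trans h1
      have h8 := (le_abs_self _).trans h3
      rw [map_sub] at h8
      have h9 : hamiltonianGrad f ℓ (θ s, x s) (p s) (y s) =
          fderiv ℝ ℓ (θ s, x s) (0, y s) + p s (fderiv ℝ f (θ s, x s) (0, y s)) := by
        simp [hamiltonianGrad, fderivSnd]
      simp only [splice_of_notMem hs]
      rw [h9, hM₂]
      linarith)
  have hT2 : M₂ * ε ^ 2 * (T - ε) ≤ M₂ * ε ^ 2 * T := by gcongr; linarith
  have hfin : ((M₁ + M₂ * T) * ε - c) * ε < 0 := mul_neg_of_neg_of_pos (by linarith) hε0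
  linarith

end MaximumPrinciple

namespace PiecewiseContinuous

variable {T : ℝ} {f g : ℝ → ℝ}

theorem exists_bound (hf : PiecewiseContinuous T f) : ∃ C, ∀ t ∈ Icc 0 T, ‖f t‖ ≤ C := by
  refine isCompact_Icc.induction_on (p := fun s => ∃ C, ∀ t ∈ s, ‖f t‖ ≤ C) (by simp)
    (fun s t hst ⟨C, hC⟩ => ⟨C, fun x hx => hC x (hst hx)⟩)
    (fun s t ⟨C, hC⟩ ⟨C', hC'⟩ => ⟨max C C', fun x hx => hx.elim
      (fun h => (hC x h).trans (le_max_left _ _))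
      (fun h => (hC' x h).trans (le_max_right _ _))⟩) fun x hx => ?_
  have key : ∀ (F : Filter ℝ) (l : ℝ), Tendsto f F (𝓝 l) → ∀ᶠ t in F, ‖f t‖ ≤ ‖l‖ + 1 :=
    fun F l h => h.norm.eventually_le_const (lt_add_one _)
  obtain ⟨C₁, h₁⟩ : ∃ C, ∀ᶠ t in 𝓝[>] x, t ∈ Icc 0 T → ‖f t‖ ≤ C := by
    rcases hx.2.lt_or_eq with h | rfl
    · obtain ⟨l, hl⟩ := hf.2.1 x ⟨hx.1, h⟩
      exact ⟨_, (key _ _ hl).mono fun _ h _ => h⟩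
    · exact ⟨0, eventually_mem_nhdsWithin.mono fun t ht h => absurd h.2 (not_le.2 ht)⟩
  obtain ⟨C₂, h₂⟩ : ∃ C, ∀ᶠ t in 𝓝[<] x, t ∈ Icc 0 T → ‖f t‖ ≤ C := by
    rcases hx.1.lt_or_eq with h | rfl
    · obtain ⟨l, hl⟩ := hf.2.2 x ⟨h, hx.2⟩
      exact ⟨_, (key _ _ hl).mono fun _ h _ => h⟩
    · exact ⟨0, eventually_mem_nhdsWithin.mono fun t ht h => absurd h.1 (not_le.2 ht)⟩
  set C := max ‖f x‖ (max C₁ C₂)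
  have h : ∀ᶠ t in 𝓝 x, t ∈ Icc 0 T → ‖f t‖ ≤ C := by
    rw [← pure_sup_nhdsNE, ← nhdsLT_sup_nhdsGT, eventually_sup, eventually_sup, eventually_pure]
    exact ⟨fun _ => le_max_left _ _,
      h₂.mono fun t h ht => (h ht).trans ((le_max_right _ _).trans (le_max_right _ _)),
      h₁.mono fun t h ht => (h ht).trans ((le_max_left _ _).trans (le_max_right _ _))⟩
  exact ⟨{t | ‖f t‖ ≤ C}, eventually_nhdsWithin_iff.2 h, C, fun t ht => ht⟩

theorem exists_bddContOff (hf : PiecewiseContinuous T f) :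
    ∃ D : Set ℝ, D.Finite ∧ BddContOff T D f := by
  obtain ⟨D, hD, h⟩ := hf.1
  exact ⟨D, hD, hf.exists_bound, fun t ht =>
    (h t ⟨Ioo_subset_Icc_self ht.1, ht.2⟩).continuousAt (Icc_mem_nhds ht.1.1 ht.1.2)⟩

theorem const (c : ℝ) : PiecewiseContinuous T fun _ => c :=
  ⟨⟨∅, finite_empty, fun _ _ => continuousWithinAt_const⟩,
    fun _ _ => ⟨c, tendsto_const_nhds⟩, fun _ _ => ⟨c, tendsto_const_nhds⟩⟩

theorem splice (hf : PiecewiseContinuous T f) (hg : PiecewiseContinuous T g) (a b : ℝ) :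
    PiecewiseContinuous T (splice a b f g) := by
  obtain ⟨⟨D, hD, hfc⟩, hfr, hfl⟩ := hf
  obtain ⟨⟨D', hD', hgc⟩, hgr, hgl⟩ := hg
  refine ⟨⟨D ∪ D' ∪ {a, b}, (hD.union hD').union (toFinite _), fun t ht => ?_⟩,
    fun t ht => ?_, fun t ht => ?_⟩
  · simp only [Set.mem_sdiff, mem_union, mem_insert_iff, mem_singleton_iff, not_or] at ht
    obtain ⟨h0, ⟨h1, h2⟩, h3, h4⟩ := ht
    rcases splice_eventuallyEq f g h3 h4 with h | h
    · exact (hfc t ⟨h0, h1⟩).congr_of_eventuallyEq (h.filter_mono inf_le_left) h.self_of_nhds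
    · exact (hgc t ⟨h0, h2⟩).congr_of_eventuallyEq (h.filter_mono inf_le_left) h.self_of_nhds
  · obtain ⟨l, hl⟩ := hfr t ht
    obtain ⟨l', hl'⟩ := hgr t ht
    by_cases h : t ∈ Ico a b
    · refine ⟨l', hl'.congr' ?_⟩
      filter_upwards [Ioo_mem_nhdsGT h.2] with s hs
      exact (splice_of_mem ⟨h.1.trans_lt hs.1, hs.2.le⟩).symm
    · refine ⟨l, hl.congr' ?_⟩
      rcases lt_or_ge t a with h' | h'
      · filter_upwards [Ioo_mem_nhdsGT h'] with s hs
        exact (splice_of_notMem fun hm => absurd hm.1 (not_lt.2 hs.2.le)).symm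
      · have hb : b ≤ t := not_lt.1 fun hb => h ⟨h', hb⟩
        filter_upwards [self_mem_nhdsWithin] with s hs
        exact (splice_of_notMem fun hm => absurd (hb.trans_lt hs) (not_lt.2 hm.2)).symm
  · obtain ⟨l, hl⟩ := hfl t ht
    obtain ⟨l', hl'⟩ := hgl t ht
    by_cases h : t ∈ Ioc a b
    · refine ⟨l', hl'.congr' ?_⟩
      filter_upwards [Ioo_mem_nhdsLT h.1] with s hs
      exact (splice_of_mem ⟨hs.1, hs.2.le.trans h.2⟩).symm
    · refine ⟨l, hl.congr' ?_⟩
      rcases le_or_gt t a with h' | h'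
      · filter_upwards [self_mem_nhdsWithin] with s hs
        exact (splice_of_notMem fun hm => absurd (hm.1.trans hs) (not_lt.2 h')).symm
      · have hb : b < t := not_le.1 fun hb => h ⟨h', hb⟩
        filter_upwards [Ioo_mem_nhdsLT hb] with s hs
        exact (splice_of_notMem fun hm => absurd hs.1 (not_lt.2 hm.2)).symm

end PiecewiseContinuous

theorem BddContOff.comp_continuousOn {T : ℝ} {D : Set ℝ} {f φ : ℝ → ℝ} {lo hi : ℝ}
    (hφ : ContinuousOn φ (Icc lo hi)) (hf : BddContOff T D f)
    (hmem : ∀ t ∈ Icc 0 T, f t ∈ Icc lo hi) : BddContOff T D (fun t => φ (f t)) := by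
  obtain ⟨C, hC⟩ := isCompact_Icc.exists_bound_of_continuousOn hφ
  refine ⟨⟨C, fun t ht => hC _ (hmem t ht)⟩, fun t ht => ?_⟩
  refine (hφ _ (hmem t (Ioo_subset_Icc_self ht.1))).tendsto.comp
    (tendsto_nhdsWithin_iff.2 ⟨hf.2 t ht, ?_⟩)
  filter_upwards [Icc_mem_nhds ht.1.1 ht.1.2] with s hs using hmem s hs

theorem BddContOff.mul {T : ℝ} {D : Set ℝ} {f g : ℝ → ℝ} (hf : BddContOff T D f)
    (hg : BddContOff T D g) : BddContOff T D (fun t => f t * g t) :=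
  (hf.prodMk hg).comp continuous_mul

theorem BddContOff.add {T : ℝ} {D : Set ℝ} {f g : ℝ → ℝ} (hf : BddContOff T D f)
    (hg : BddContOff T D g) : BddContOff T D (fun t => f t + g t) :=
  (hf.prodMk hg).comp continuous_add

/-- A choice of a finite exceptional set for each member of a finite family can be made uniform. -/
theorem exists_bddContOff_pi {E : Type*} [NormedAddCommGroup E] {ι : Type*} [Fintype ι] {T : ℝ}
    {g : ℝ → ι → E}
    (h : ∀ i, ∃ D : Set ℝ, D.Finite ∧ BddContOff T D (fun t => g t i)) :
    ∃ D : Set ℝ, D.Finite ∧ BddContOff T D g := by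
  choose D hD hg using h
  exact ⟨⋃ i, D i, finite_iUnion hD, BddContOff.pi fun i => (hg i).mono (subset_iUnion D i)⟩

theorem exists_bddContOff_prod {E F : Type*} [NormedAddCommGroup E] [NormedAddCommGroup F] {T : ℝ}
    {g : ℝ → E} {h : ℝ → F} (hg : ∃ D : Set ℝ, D.Finite ∧ BddContOff T D g)
    (hh : ∃ D : Set ℝ, D.Finite ∧ BddContOff T D h) :
    ∃ D : Set ℝ, D.Finite ∧ BddContOff T D (fun t => (g t, h t)) := by
  obtain ⟨D, hD, hg⟩ := hg
  obtain ⟨D', hD', hh⟩ := hh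
  exact ⟨D ∪ D', hD.union hD',
    (hg.mono subset_union_left).prodMk (hh.mono subset_union_right)⟩

theorem Schedule.bddContOff_a {N : ℕ} {T : ℝ} (G : Schedule N T) (i j : Fin N) :
    BddContOff T (range G.time) (fun t => G.a t i j) := by
  have h : BddContOff T (range G.time) (fun t k =>
      splice (G.time (Fin.castSucc k)) (G.time k.succ) (fun _ => 0) (fun _ => G.A k i j) t) := by
    refine BddContOff.pi fun k => ?_
    refine (BddContOff.splice (D := ∅) (D' := ∅) (BddContOff.of_continuousOn continuousOn_const)
      (BddContOff.of_continuousOn continuousOn_const)).mono ?_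
    simp [insert_subset_iff]
  have h' := h.comp (φ := fun v => ∑ k, v k) (by fun_prop)
  simpa only [Schedule.a, splice, mem_Ioc] using h'

/-- The time-dependent parameters `(β, λ, δ, γ, φ(δ), ϱ¹(γ) + ϱ²(1 - γ), α a)` of the problem. -/
abbrev Params (N : ℕ) : Type :=
  (Fin N → ℝ) × (Fin N → ℝ) × (Fin N → ℝ) × (Fin N → ℝ) × (Fin N → ℝ) × (Fin N → ℝ) ×
    (Fin N → Fin N → ℝ)

/-- The state space as a normed space. -/
abbrev StateVec (N : ℕ) : Type := (Fin N → ℝ) × (Fin N → ℝ) × (Fin N → ℝ)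

def StateVec.toState {N : ℕ} (x : StateVec N) : State N := ⟨x.1, x.2.1, x.2.2⟩

def State.toVec {N : ℕ} (E : State N) : StateVec N := (E.H, E.M, E.S)

/-- The infection rate as a polynomial in parameters and state. -/
noncomputable def infectionPoly {N : ℕ} (q : Params N × StateVec N) (i : Fin N) : ℝ :=
  q.1.1 i + ∑ j, q.1.2.2.2.2.2.2 i j * q.2.2.1 j + ∑ j, q.1.2.2.2.2.2.2 i j * q.2.2.2 j

/-- The right-hand side of the state system as a polynomial in parameters and state. -/
noncomputable def field {N : ℕ} (q : Params N × StateVec N) : StateVec N :=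
  (fun i => q.1.2.2.2.1 i * (1 - q.2.1 i - q.2.2.1 i - q.2.2.2 i) - q.2.1 i * infectionPoly q i,
    fun i => q.2.1 i * infectionPoly q i - q.1.2.1 i * q.2.2.1 i,
    fun i => q.1.2.1 i * q.2.2.1 i - q.1.2.2.1 i * q.2.2.2 i)

theorem contDiff_field {N : ℕ} : ContDiff ℝ 2 (field : Params N × StateVec N → StateVec N) := by
  have h : ∀ i, ContDiff ℝ 2 (fun q : Params N × StateVec N => infectionPoly q i) := by
    intro i
    unfold infectionPoly
    fun_prop
  unfold field
  fun_prop

/-- The functional with coordinates `(κ, ρ, ξ)`, as a costate. -/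
noncomputable def toCostate {N : ℕ} (p : StateVec N →L[ℝ] ℝ) : Costate N :=
  ⟨fun i => p (Pi.single i 1, 0, 0), fun i => p (0, Pi.single i 1, 0),
    fun i => p (0, 0, Pi.single i 1)⟩

theorem apply_eq_sum_toCostate {N : ℕ} (p : StateVec N →L[ℝ] ℝ) (v : StateVec N) :
    p v = ∑ i, (toCostate p).kap i * v.1 i + ∑ i, (toCostate p).rho i * v.2.1 i +
      ∑ i, (toCostate p).xi i * v.2.2 i := by
  have h : ∀ (L : (Fin N → ℝ) →L[ℝ] ℝ) (u : Fin N → ℝ),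
      L u = ∑ i, L (Pi.single i 1) * u i := by
    intro L u
    conv_lhs => rw [pi_eq_sum_univ' u, map_sum]
    refine Finset.sum_congr rfl fun i _ => ?_
    rw [map_smul, smul_eq_mul, mul_comm]
  have h1 := h (p.comp (ContinuousLinearMap.inl ℝ _ _)) v.1
  have h2 := h (p.comp ((ContinuousLinearMap.inr ℝ _ _).comp (ContinuousLinearMap.inl ℝ _ _))) v.2.1
  have h3 := h (p.comp ((ContinuousLinearMap.inr ℝ _ _).comp (ContinuousLinearMap.inr ℝ _ _))) v.2.2
  simp only [ContinuousLinearMap.comp_apply, ContinuousLinearMap.inl_apply,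
    ContinuousLinearMap.inr_apply] at h1 h2 h3
  have hv : v = (v.1, 0) + ((0, v.2.1, 0) + (0, 0, v.2.2)) := by ext <;> simp
  conv_lhs => rw [hv, map_add, map_add]
  simp only [toCostate]
  rw [add_assoc]
  exact congrArg₂ _ h1 (congrArg₂ _ h2 h3)

namespace Problem

variable {N : ℕ} (P : Problem N)

/-- The parameters at time `t` under the control value `u`. -/
noncomputable def params (t : ℝ) (u : Control N) : Params N :=
  (fun i => P.beta i t, u.lam, u.del, u.gam, fun i => P.phi i (u.del i),
    fun i => P.vrho1 i (u.gam i) + P.vrho2 i (1 - u.gam i),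
    fun i j => P.alpha i t * P.G.a t i j)

/-- The running cost as a polynomial in parameters and state. -/
noncomputable def cost (q : Params N × StateVec N) : ℝ :=
  ∑ i, ((q.1.2.2.2.2.1 i + P.a2 i) * q.2.2.2 i + P.a1 i * q.2.2.1 i) +
  ∑ i, (P.b i + q.1.2.2.2.2.2.1 i) * (1 - q.2.1 i - q.2.2.1 i - q.2.2.2 i)

theorem contDiff_cost : ContDiff ℝ 2 P.cost := by
  unfold cost
  fun_prop

theorem infectionPoly_params (t : ℝ) (u : Control N) (x : StateVec N) (i : Fin N) :
    infectionPoly (P.params t u, x) i = P.infection t x.toState i := by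
  simp [infectionPoly, infection, params, StateVec.toState, Finset.mul_sum, mul_assoc]

theorem field_params (t : ℝ) (u : Control N) (x : StateVec N) :
    field (P.params t u, x) =
      (P.dH t x.toState u, P.dM t x.toState u, P.dS x.toState u) := by
  simp only [field, infectionPoly_params]
  rfl

theorem cost_params (t : ℝ) (u : Control N) (x : StateVec N) :
    P.cost (P.params t u, x) = P.runningCost x.toState u := by
  simp [cost, runningCost, params, StateVec.toState, State.Q, add_assoc]

theorem hamiltonian_toCostate (t : ℝ) (u : Control N) (x : StateVec N) (p : StateVec N →L[ℝ] ℝ) :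
    P.hamiltonian t x.toState u (toCostate p) =
      P.cost (P.params t u, x) + p (field (P.params t u, x)) := by
  rw [apply_eq_sum_toCostate, field_params, cost_params, hamiltonian]
  ring

theorem exists_bddContOff_params {w : ℝ → Control N} (hw : w ∈ P.admissible) :
    ∃ D : Set ℝ, D.Finite ∧ BddContOff P.T D (fun t => P.params t (w t)) := by
  have hdel := fun i => (hw.1 i).2.1.exists_bddContOff
  have hgam := fun i => (hw.1 i).2.2.exists_bddContOff
  refine exists_bddContOff_prod (exists_bddContOff_pi fun i => (P.beta_pc i).exists_bddContOff)
    <| exists_bddContOff_prod (exists_bddContOff_pi fun i => (hw.1 i).1.exists_bddContOff)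
    <| exists_bddContOff_prod (exists_bddContOff_pi hdel)
    <| exists_bddContOff_prod (exists_bddContOff_pi hgam)
    <| exists_bddContOff_prod (exists_bddContOff_pi fun i => ?_)
    <| exists_bddContOff_prod (exists_bddContOff_pi fun i => ?_)
    (exists_bddContOff_pi fun i => exists_bddContOff_pi fun j => ?_)
  · obtain ⟨D, hD, h⟩ := hdel i
    exact ⟨D, hD, h.comp_continuousOn (P.phi_cont i) fun t ht => (hw.2 t ht i).2.1⟩
  · obtain ⟨D, hD, h⟩ := hgam i
    refine ⟨D, hD, (h.comp_continuousOn (P.vrho1_cont i) fun t ht => (hw.2 t ht i).2.2).add ?_⟩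
    refine (h.comp (φ := fun s => 1 - s) (by fun_prop)).comp_continuousOn (P.vrho2_cont i)
      fun t ht => ?_
    have := (hw.2 t ht i).2.2
    exact ⟨by linarith [this.2], by linarith [this.1]⟩
  · obtain ⟨D, hD, h⟩ := (P.alpha_pc i).exists_bddContOff
    exact ⟨D ∪ range P.G.time, hD.union (finite_range _), (h.mono subset_union_left).mul
      ((P.G.bddContOff_a i j).mono subset_union_right)⟩

theorem splice_mem_admissible {w w' : ℝ → Control N} (hw : w ∈ P.admissible)
    (hw' : w' ∈ P.admissible) (a b : ℝ) : splice a b w w' ∈ P.admissible := by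
  refine ⟨fun i => ⟨?_, ?_, ?_⟩, fun t ht i => ?_⟩
  · simp only [fun t => apply_splice (fun u : Control N => u.lam i) a b w w' t]
    exact (hw.1 i).1.splice (hw'.1 i).1 a b
  · simp only [fun t => apply_splice (fun u : Control N => u.del i) a b w w' t]
    exact (hw.1 i).2.1.splice (hw'.1 i).2.1 a b
  · simp only [fun t => apply_splice (fun u : Control N => u.gam i) a b w w' t]
    exact (hw.1 i).2.2.splice (hw'.1 i).2.2 a b
  · by_cases h : t ∈ Ioc a b
    · rw [splice_of_mem h]; exact hw'.2 t ht i
    · rw [splice_of_notMem h]; exact hw.2 t ht i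

theorem params_splice (w w' : ℝ → Control N) (a b t : ℝ) :
    P.params t (splice a b w w' t) =
      splice a b (fun t => P.params t (w t)) (fun t => P.params t (w' t)) t :=
  apply_ite (P.params t) _ _ _

variable {P}

theorem IsStateTrajectory.exists_hasDerivAt {w : ℝ → Control N} {E : ℝ → State N}
    (h : P.IsStateTrajectory w E) :
    ContinuousOn (fun t => (E t).toVec) (Icc 0 P.T) ∧
    ∃ D : Set ℝ, D.Finite ∧ ∀ t ∈ Ioo 0 P.T \ D, HasDerivAt (fun s => (E s).toVec)
      (field (P.params t (w t), (E t).toVec)) t := by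
  obtain ⟨-, hc, D, hD, hd⟩ := h
  refine ⟨(continuousOn_pi.2 fun i => (hc i).1).prodMk ((continuousOn_pi.2 fun i => (hc i).2.1).prodMk
    (continuousOn_pi.2 fun i => (hc i).2.2)), D, hD, fun t ht => ?_⟩
  rw [field_params]
  exact (hasDerivAt_pi.2 fun i => (hd t ht i).1).prodMk
    ((hasDerivAt_pi.2 fun i => (hd t ht i).2.1).prodMk
      (hasDerivAt_pi.2 fun i => (hd t ht i).2.2))

theorem isStateTrajectory_of_hasDerivAt {w : ℝ → Control N} {x : ℝ → StateVec N} {D : Set ℝ}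
    (h0 : x 0 = P.E0.toVec) (hc : ContinuousOn x (Icc 0 P.T)) (hD : D.Finite)
    (hd : ∀ t ∈ Ioo 0 P.T \ D, HasDerivAt x (field (P.params t (w t), x t)) t) :
    P.IsStateTrajectory w (fun t => (x t).toState) := by
  refine ⟨by simp only [h0]; rfl, fun i => ⟨?_, ?_, ?_⟩, D, hD, fun t ht i => ?_⟩
  · exact (continuous_apply i |>.comp continuous_fst).comp_continuousOn hc
  · exact (continuous_apply i |>.comp (continuous_fst.comp continuous_snd)).comp_continuousOn hc
  · exact (continuous_apply i |>.comp (continuous_snd.comp continuous_snd)).comp_continuousOn hc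
  · have h := hd t ht
    rw [field_params] at h
    have h1 : HasDerivAt (fun s => (x s).1) (P.dH t (x t).toState (w t)) t := by
      simpa using h.hasFDerivAt.fst.hasDerivAt
    have h2 : HasDerivAt (fun s => (x s).2.1) (P.dM t (x t).toState (w t)) t := by
      simpa using h.hasFDerivAt.snd.fst.hasDerivAt
    have h3 : HasDerivAt (fun s => (x s).2.2) (P.dS (x t).toState (w t)) t := by
      simpa using h.hasFDerivAt.snd.snd.hasDerivAt
    exact ⟨hasDerivAt_pi.1 h1 i, hasDerivAt_pi.1 h2 i, hasDerivAt_pi.1 h3 i⟩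

end Problem

/-- A function that is non-negative off a finite set is non-negative at `t` if it inherits the
one-sided continuity at `t` of another function. -/
theorem OneSidedContinuousAt.nonneg {T t : ℝ} {f g : ℝ → ℝ} (hf : OneSidedContinuousAt T f t)
    (ht : t ∈ Icc 0 T) {D : Set ℝ} (hD : D.Finite) (hpos : ∀ s ∈ Ioo 0 T \ D, 0 ≤ g s)
    (hg : ∀ A ⊆ Icc 0 T, ContinuousWithinAt f A t → ContinuousWithinAt g A t) : 0 ≤ g t := by
  have hDt : ∀ᶠ s in 𝓝 t, s ∉ D \ {t} :=
    (hD.subset sdiff_subset).isClosed.isOpen_compl.mem_nhds (by simp)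
  rcases hf with ⟨h, hc⟩ | ⟨h, hc⟩
  · have hlim := hg _ (Icc_subset_Icc_left ht.1) hc
    refine ge_of_tendsto (hlim.tendsto.mono_left (nhdsWithin_le_of_mem (Icc_mem_nhdsGT h))) ?_
    filter_upwards [Ioo_mem_nhdsGT h, hDt.filter_mono inf_le_left] with s hs hs'
    exact hpos s ⟨⟨ht.1.trans_lt hs.1, hs.2⟩, fun h' => hs' ⟨h', hs.1.ne'⟩⟩
  · have hlim := hg _ (Icc_subset_Icc_right ht.2) hc
    refine ge_of_tendsto (hlim.tendsto.mono_left (nhdsWithin_le_of_mem (Icc_mem_nhdsLT h))) ?_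
    filter_upwards [Ioo_mem_nhdsLT h, hDt.filter_mono inf_le_left] with s hs hs'
    exact hpos s ⟨⟨hs.1, hs.2.trans_le ht.2⟩, fun h' => hs' ⟨h', hs.2.ne⟩⟩

theorem le_of_sum_le_sum_of_eq_off {ι : Type*} [Fintype ι] {g g' : ι → ℝ} (i : ι)
    (h : ∑ j, g j ≤ ∑ j, g' j) (heq : ∀ j, j ≠ i → g j = g' j) : g i ≤ g' i := by
  classical
  rw [Fintype.sum_eq_add_sum_compl i, Fintype.sum_eq_add_sum_compl i g',
    Finset.sum_congr rfl fun j hj => heq j (by simpa using hj)] at h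
  linarith

namespace Problem

variable {N : ℕ} (P : Problem N)

/-- The part of the Hamiltonian that belongs to node `i`, at the control values `l, d, g`. -/
noncomputable def nodeHamiltonian (t : ℝ) (E : State N) (p : Costate N) (i : Fin N)
    (l d g : ℝ) : ℝ :=
  ((P.phi i d + P.a2 i) * E.S i + P.a1 i * E.M i) +
    (P.b i + P.vrho1 i g + P.vrho2 i (1 - g)) * E.Q i +
    p.kap i * (g * E.Q i - E.H i * P.infection t E i) +
    p.rho i * (E.H i * P.infection t E i - l * E.M i) + p.xi i * (l * E.M i - d * E.S i)

theorem hamiltonian_eq_sum (t : ℝ) (E : State N) (u : Control N) (p : Costate N) :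
    P.hamiltonian t E u p = ∑ i, P.nodeHamiltonian t E p i (u.lam i) (u.del i) (u.gam i) := by
  simp only [hamiltonian, runningCost, dH, dM, dS, nodeHamiltonian, Finset.sum_add_distrib]

/-- Replacing the control at node `i` keeps it admissible. -/
theorem update_mem_admissible {w : ℝ → Control N} (hw : w ∈ P.admissible) (i : Fin N)
    {l d g : ℝ → ℝ} (hl : PiecewiseContinuous P.T l) (hd : PiecewiseContinuous P.T d)
    (hg : PiecewiseContinuous P.T g)
    (hmem : ∀ t ∈ Icc 0 P.T, l t ∈ Icc (P.lamLo i) (P.lamHi i) ∧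
      d t ∈ Icc (P.delLo i) (P.delHi i) ∧ g t ∈ Icc (P.gamLo i) (P.gamHi i)) :
    (fun t => (⟨Function.update (w t).lam i (l t), Function.update (w t).del i (d t),
      Function.update (w t).gam i (g t)⟩ : Control N)) ∈ P.admissible := by
  refine ⟨fun j => ?_, fun t ht j => ?_⟩
  · rcases eq_or_ne j i with rfl | h
    · simpa using ⟨hl, hd, hg⟩
    · simpa [h] using hw.1 j
  · rcases eq_or_ne j i with rfl | h
    · simpa using hmem t ht
    · simpa [h] using hw.2 t ht j

theorem hasDerivAt_hamiltonian (t : ℝ) (u : Control N) (p : StateVec N →L[ℝ] ℝ)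
    {c : ℝ → StateVec N} {v x : StateVec N} {s : ℝ} (hc : HasDerivAt c v s) (hs : c s = x) :
    HasDerivAt (fun y => P.hamiltonian t (c y).toState u (toCostate p))
      (hamiltonianGrad field P.cost (P.params t u, x) p v) s := by
  subst hs
  simp only [hamiltonian_toCostate]
  have h : HasDerivAt (fun y => (P.params t u, c y)) ((0 : Params N), v) s :=
    (hasDerivAt_const s _).prodMk hc
  have h1 := ((P.contDiff_cost.differentiable (by norm_num)) _).hasFDerivAt.comp_hasDerivAt s h
  have h2 := ((contDiff_field.differentiable (by norm_num)) _).hasFDerivAt.comp_hasDerivAt s h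
  exact h1.add (p.hasFDerivAt.comp_hasDerivAt s h2)

variable {P}

theorem isAdjoint_toCostate {w : ℝ → Control N} {E : ℝ → State N} {D : Set ℝ} (hD : D.Finite)
    {p : ℝ → StateVec N →L[ℝ] ℝ} (hpc : Continuous p) (hpT : p P.T = 0)
    (hp : ∀ t ∈ Ioo 0 P.T \ D, HasDerivAt p
      (-hamiltonianGrad field P.cost (P.params t (w t), (E t).toVec) (p t)) t) :
    P.IsAdjoint w E (fun t => toCostate (p t)) := by
  refine ⟨fun i => by simp [toCostate, hpT], fun i => ⟨?_, ?_, ?_⟩, D, hD, fun t ht i => ?_⟩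
  · exact (hpc.clm_apply continuous_const).continuousOn
  · exact (hpc.clm_apply continuous_const).continuousOn
  · exact (hpc.clm_apply continuous_const).continuousOn
  have hpv : ∀ v : StateVec N, HasDerivAt (fun s => p s v)
      (-hamiltonianGrad field P.cost (P.params t (w t), (E t).toVec) (p t) v) t := fun v => by
    simpa using (hp t ht).clm_apply (hasDerivAt_const t v)
  refine ⟨⟨_, P.hasDerivAt_hamiltonian t (w t) (p t)
      (c := fun y => (Function.update (E t).H i y, (E t).M, (E t).S))
      ((hasDerivAt_update _ i _).prodMk (hasDerivAt_const _ _)) ?_, hpv _⟩,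
    ⟨_, P.hasDerivAt_hamiltonian t (w t) (p t)
      (c := fun y => ((E t).H, Function.update (E t).M i y, (E t).S))
      ((hasDerivAt_const _ _).prodMk ((hasDerivAt_update _ i _).prodMk (hasDerivAt_const _ _)))
      ?_, hpv _⟩,
    ⟨_, P.hasDerivAt_hamiltonian t (w t) (p t)
      (c := fun y => ((E t).H, (E t).M, Function.update (E t).S i y))
      ((hasDerivAt_const _ _).prodMk ((hasDerivAt_const _ _).prodMk (hasDerivAt_update _ i _)))
      ?_, hpv _⟩⟩ <;>
  simp [State.toVec]

/-- The maximum principle for the prevention and control problem. -/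
theorem IsOptimal.exists_adjoint {w : ℝ → Control N} {E : ℝ → State N} (hopt : P.IsOptimal w E) :
    ∃ p : ℝ → Costate N, P.IsAdjoint w E p ∧ ∀ w' ∈ P.admissible, ∃ D : Set ℝ, D.Finite ∧
      ∀ t ∈ Ioo 0 P.T \ D,
        P.hamiltonian t (E t) (w t) (p t) ≤ P.hamiltonian t (E t) (w' t) (p t) := by
  obtain ⟨hw, hE, hmin⟩ := hopt
  obtain ⟨D₁, hD₁, hθ⟩ := P.exists_bddContOff_params hw
  obtain ⟨hxc, D₂, hD₂, hx⟩ := hE.exists_hasDerivAt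
  have hD : (D₁ ∪ D₂).Finite := hD₁.union hD₂
  replace hθ := hθ.mono (D' := D₁ ∪ D₂) subset_union_left
  replace hx := fun t (ht : t ∈ Ioo 0 P.T \ (D₁ ∪ D₂)) =>
    hx t ⟨ht.1, fun h => ht.2 (subset_union_right h)⟩
  obtain ⟨p, hpc, hpT, hp⟩ := PPAC.exists_adjoint contDiff_field P.contDiff_cost P.T_pos hD hθ
    (BddContOff.of_continuousOn hxc)
  refine ⟨_, isAdjoint_toCostate hD hpc hpT hp, fun w' hw' => ?_⟩
  obtain ⟨D', hD', hη⟩ := P.exists_bddContOff_params hw'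
  refine ⟨(D₁ ∪ D₂) ∪ D', hD.union hD', fun a ha => ?_⟩
  have hJ : ∀ (w : ℝ → Control N) (x : ℝ → StateVec N), P.impact w (fun t => (x t).toState) =
      ∫ t in (0 : ℝ)..P.T, P.cost (P.params t (w t), x t) := fun w x => by
    simp only [impact, cost_params]
  have hE0 : (E 0).toVec = P.E0.toVec := by rw [hE.1]
  have h := hamiltonian_le_of_needle contDiff_field P.contDiff_cost P.T_pos hD hD' hθ hη hxc hx
    hpc hpT hp ha fun ε hε hεT D'' x' hD'' hc h0 hd => by
      simp only [← P.params_splice] at hd ⊢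
      rw [← hJ, ← hJ]
      exact hmin _ (P.splice_mem_admissible hw hw' _ _) _
        (isStateTrajectory_of_hasDerivAt (h0.trans hE0) hc hD'' hd)
  rwa [← hamiltonian_toCostate, ← hamiltonian_toCostate] at h

end Problem

end PPAC

theorem mainTheorem5 (N : ℕ) (P : PPAC.Problem N) (w : ℝ → PPAC.Control N) (E : ℝ → PPAC.State N)
    (hopt : P.IsOptimal w E) :
    ∃ p : ℝ → PPAC.Costate N, P.IsAdjoint w E p ∧
      ∀ t ∈ Set.Icc 0 P.T, ∀ i : Fin N,
        (PPAC.OneSidedContinuousAt P.T (fun s => (w s).del i) t →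
          (w t).del i ∈ PPAC.argminOn
            (fun d => (E t).S i * (P.phi i d - (p t).xi i * d))
            (Set.Icc (P.delLo i) (P.delHi i))) ∧
        (PPAC.OneSidedContinuousAt P.T (fun s => (w s).lam i) t →
          (w t).lam i ∈ PPAC.argminOn
            (fun l => (E t).M i * ((p t).xi i * l - (p t).rho i * l))
            (Set.Icc (P.lamLo i) (P.lamHi i))) ∧
        (PPAC.OneSidedContinuousAt P.T (fun s => (w s).gam i) t →
          (w t).gam i ∈ PPAC.argminOn
            (fun g => (E t).Q i * (P.vrho1 i g + P.vrho2 i (1 - g) + (p t).kap i * g))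
            (Set.Icc (P.gamLo i) (P.gamHi i))) := by
  obtain ⟨p, hp, hle⟩ := hopt.exists_adjoint
  refine ⟨p, hp, fun t ht i => ?_⟩
  obtain ⟨hw, hE, -⟩ := hopt
  have hnode : ∀ l d g : ℝ → ℝ, PPAC.PiecewiseContinuous P.T l → PPAC.PiecewiseContinuous P.T d →
      PPAC.PiecewiseContinuous P.T g →
      (∀ t ∈ Icc 0 P.T, l t ∈ Icc (P.lamLo i) (P.lamHi i) ∧
        d t ∈ Icc (P.delLo i) (P.delHi i) ∧ g t ∈ Icc (P.gamLo i) (P.gamHi i)) →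
      ∃ D : Set ℝ, D.Finite ∧ ∀ s ∈ Ioo 0 P.T \ D,
        P.nodeHamiltonian s (E s) (p s) i ((w s).lam i) ((w s).del i) ((w s).gam i) ≤
          P.nodeHamiltonian s (E s) (p s) i (l s) (d s) (g s) := by
    intro l d g hl hd hg hmem
    obtain ⟨D, hD, h⟩ := hle _ (P.update_mem_admissible hw i hl hd hg hmem)
    refine ⟨D, hD, fun s hs => ?_⟩
    have h1 := h s hs
    rw [P.hamiltonian_eq_sum, P.hamiltonian_eq_sum] at h1
    simpa using PPAC.le_of_sum_le_sum_of_eq_off i h1 fun j hj => by simp [hj]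
  obtain ⟨hlam, hdel, hgam⟩ := hw.1 i
  have hbox := fun s hs => hw.2 s hs i
  have cH := (hE.2.1 i).1 t ht
  have cM := (hE.2.1 i).2.1 t ht
  have cS := (hE.2.1 i).2.2 t ht
  have ckap := (hp.2.1 i).1 t ht
  have crho := (hp.2.1 i).2.1 t ht
  have cxi := (hp.2.1 i).2.2 t ht
  refine ⟨fun hc => ⟨(hbox t ht).2.1, fun v hv => ?_⟩, fun hc => ⟨(hbox t ht).1, fun v hv => ?_⟩,
    fun hc => ⟨(hbox t ht).2.2, fun v hv => ?_⟩⟩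
  · obtain ⟨D, hD, h⟩ := hnode _ (fun _ => v) _ hlam (.const v) hgam
      fun s hs => ⟨(hbox s hs).1, hv, (hbox s hs).2.2⟩
    refine sub_nonneg.1 (hc.nonneg (g := fun s => (E s).S i * (P.phi i v - (p s).xi i * v) -
      (E s).S i * (P.phi i ((w s).del i) - (p s).xi i * (w s).del i)) ht hD
      (fun s hs => ?_) fun A hA hcA => ?_)
    · have h1 := h s hs
      simp only [PPAC.Problem.nodeHamiltonian] at h1
      linarith
    · have h1 := ContinuousWithinAt.comp (f := fun s => (w s).del i)
        (P.phi_cont i _ (hbox t ht).2.1) hcA fun s hs => (hbox s (hA hs)).2.1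
      exact ((cS.mono hA).mul (continuousWithinAt_const.sub ((cxi.mono hA).mul
        continuousWithinAt_const))).sub ((cS.mono hA).mul (h1.sub ((cxi.mono hA).mul hcA)))
  · obtain ⟨D, hD, h⟩ := hnode (fun _ => v) _ _ (.const v) hdel hgam
      fun s hs => ⟨hv, (hbox s hs).2.1, (hbox s hs).2.2⟩
    refine sub_nonneg.1 (hc.nonneg (g := fun s => (E s).M i * ((p s).xi i * v - (p s).rho i * v) -
      (E s).M i * ((p s).xi i * (w s).lam i - (p s).rho i * (w s).lam i)) ht hD
      (fun s hs => ?_) fun A hA hcA => ?_)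
    · have h1 := h s hs
      simp only [PPAC.Problem.nodeHamiltonian] at h1
      linarith
    · have h1 := cxi.mono hA
      have h2 := crho.mono hA
      exact ((cM.mono hA).mul ((h1.mul continuousWithinAt_const).sub
        (h2.mul continuousWithinAt_const))).sub
        ((cM.mono hA).mul ((h1.mul hcA).sub (h2.mul hcA)))
  · obtain ⟨D, hD, h⟩ := hnode _ _ (fun _ => v) hlam hdel (.const v)
      fun s hs => ⟨(hbox s hs).1, (hbox s hs).2.1, hv⟩
    refine sub_nonneg.1 (hc.nonneg (g := fun s => (E s).Q i *
      (P.vrho1 i v + P.vrho2 i (1 - v) + (p s).kap i * v) - (E s).Q i *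
      (P.vrho1 i ((w s).gam i) + P.vrho2 i (1 - (w s).gam i) + (p s).kap i * (w s).gam i)) ht hD
      (fun s hs => ?_) fun A hA hcA => ?_)
    · have h1 := h s hs
      simp only [PPAC.Problem.nodeHamiltonian] at h1
      linarith
    · have h1 := ContinuousWithinAt.comp (f := fun s => (w s).gam i)
        (P.vrho1_cont i _ (hbox t ht).2.2) hcA fun s hs => (hbox s (hA hs)).2.2
      have hm : ∀ s ∈ Icc 0 P.T, 1 - (w s).gam i ∈ Icc (1 - P.gamHi i) (1 - P.gamLo i) :=
        fun s hs => ⟨by linarith [(hbox s hs).2.2.2], by linarith [(hbox s hs).2.2.1]⟩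
      have h2 := ContinuousWithinAt.comp (f := fun s => 1 - (w s).gam i)
        (P.vrho2_cont i _ (hm t ht)) (continuousWithinAt_const.sub hcA) fun s hs => hm s (hA hs)
      have hQ : ContinuousWithinAt (fun s => (E s).Q i) A t :=
        ((continuousWithinAt_const.sub (cH.mono hA)).sub (cM.mono hA)).sub (cS.mono hA)
      exact (hQ.mul (continuousWithinAt_const.add ((ckap.mono hA).mul
        continuousWithinAt_const))).sub (hQ.mul ((h1.add h2).add ((ckap.mono hA).mul hcA)))
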